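/- Let $m,n\ge 0$ be integers and let $G\subseteq K_{m,n}$ be a connected bipartite graph with vertex set $V=U_1\sqcup U_2$, $|U_1|=m$, $|U_2|=n$ (a spanning subgraph of $K_{m,n}$). Let $I_G$ be the kernel of the $\mathbb{C}$-algebra homomorphism $\mathbb{C}[x_e : e\in E(G)]\to\mathbb{C}[t_v : v\in V]$, $x_e\mapsto t_it_j$ for $e=\{i,j\}$, and let $TV(G)=\operatorname{Spec}(\mathbb{C}[x_e : e\in E(G)]/I_G)$ be the associated affine toric variety. Let $e_1,\dots,e_m,f_1,\dots,f_n$ be the canonical basis of $\mathbb{Z}^{m+n}$, put $(1,-1)=\sum_i e_i-\sum_j f_j$, $N=\mathbb{Z}^{m+n}/\mathbb{Z}(1,-1)$, $N_{\mathbb{Q}}=\mathbb{Q}^{m+n}/\mathbb{Q}(1,-1)$ and $M_{\mathbb{Q}}=(1,-1)^{\perp}\subseteq\mathbb{Q}^{m+n}$, paired by the standard scalar product. Let $\sigma_G^{\vee}\subseteq M_{\mathbb{Q}}$ be the cone generated by the vectors $e^i+f^j$ over all edges $(i,j)\in E(G)$, where $e^i,f^j$ denote the canonical basis vectors of $\mathbb{Q}^{m+n}$,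 and let the edge cone $\sigma_G=\{a\in N_{\mathbb{Q}} : \langle b,a\rangle\ge 0 \text{ for all } b\in\sigma_G^{\vee}\}$ be its dual. Then $TV(G)$ is smooth in codimension $2$, i.e. $TV(G)$ is smooth over $\mathbb{C}$ at every point $x$ with $\dim\mathcal{O}_{TV(G),x}\le 2$. Moreover (this is the equivalent formulation in terms of the cone), every $2$-dimensional face of $\sigma_G$ is generated, as a cone, by (the images in $N_{\mathbb{Q}}$ of) part of a $\mathbb{Z}$-basis of $N$. -/

import Mathlib

open AlgebraicGeometry CategoryTheory

noncomputable section

namespace BipartiteToric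

/-! ### The edge ideal and the affine toric variety of a graph -/

section Variety

variable {V : Type} (G : SimpleGraph V)

/-- The morphism `ℂ[x_e | e ∈ E(G)] → ℂ[t_v | v ∈ V(G)]` with `x_e ↦ t_i t_j` for `e = {i, j}`.
Its range is the edge ring of `G`. -/
def edgeHom : MvPolynomial G.edgeSet ℂ →ₐ[ℂ] MvPolynomial V ℂ :=
  MvPolynomial.aeval fun e => (e.1.map (MvPolynomial.X (R := ℂ))).mul

/-- The edge ideal `I_G`: the kernel of `x_e ↦ t_i t_j`. -/
def edgeIdeal : Ideal (MvPolynomial G.edgeSet ℂ) :=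
  RingHom.ker (edgeHom G)

/-- The coordinate ring `ℂ[x_e | e ∈ E(G)] / I_G`. -/
abbrev CoordRing : Type :=
  MvPolynomial G.edgeSet ℂ ⧸ edgeIdeal G

/-- The affine toric variety `TV(G) = Spec (ℂ[x_e | e ∈ E(G)] / I_G)`. -/
abbrev TV : Scheme :=
  Spec (CommRingCat.of (CoordRing G))

/-- The structure morphism `TV(G) → Spec ℂ`. -/
def TV.structureMap : TV G ⟶ Spec (CommRingCat.of ℂ) :=
  Spec.map (CommRingCat.ofHom (algebraMap ℂ (CoordRing G)))

instance [Finite V] : LocallyOfFinitePresentation (TV.structureMap G) := by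
  have : Finite G.edgeSet := Subtype.finite
  have h : (algebraMap ℂ (CoordRing G)).FinitePresentation := by
    rw [← RingHom.FinitePresentation.of_finiteType, RingHom.finiteType_algebraMap]
    infer_instance
  exact (HasRingHomProperty.Spec_iff (P := @LocallyOfFinitePresentation)).mpr h

end Variety

/-- A scheme `X` locally of finite presentation over `S` is smooth in codimension `k` if `X` is
smooth over `S` at every point `x` of codimension `dim 𝒪_{X,x} ≤ k`; in other words, the
non-smooth locus has codimension greater than `k`. -/
def SmoothInCodim {X S : Scheme} (f : X ⟶ S) [LocallyOfFinitePresentation f] (k : ℕ) : Prop :=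
  ∀ x : X, ringKrullDim (X.presheaf.stalk x) ≤ k → x ∈ f.smoothLocus

/-! ### The lattice `N`, the edge cone and its faces

The vertices of `K_{m,n}` are `Fin m ⊕ Fin n`, with `U₁ = Fin m` and `U₂ = Fin n`. -/

section Cone

variable (m n : ℕ)

/-- The vector `(1, -1) = ∑ e_i - ∑ f_j` in `R^{m+n}`. -/
def oneNegOne (R : Type) [Ring R] : Fin m ⊕ Fin n → R :=
  Sum.elim (fun _ => 1) (fun _ => -1)

/-- The lattice `N = ℤ^{m+n} / ℤ(1, -1)`. -/
abbrev N : Type :=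
  (Fin m ⊕ Fin n → ℤ) ⧸ Submodule.span ℤ {oneNegOne m n ℤ}

/-- The rational vector space `N_ℚ = ℚ^{m+n} / ℚ(1, -1)`. -/
abbrev NQ : Type :=
  (Fin m ⊕ Fin n → ℚ) ⧸ Submodule.span ℚ {oneNegOne m n ℚ}

/-- The rational vector space `M_ℚ = (1, -1)^⊥` in `ℚ^{m+n}`. -/
def MQ : Submodule ℚ (Fin m ⊕ Fin n → ℚ) :=
  LinearMap.ker ((dotProductBilin ℚ ℚ).flip (oneNegOne m n ℚ))

variable {m n}

/-- The canonical map `N → N_ℚ`, induced by the inclusion `ℤ^{m+n} → ℚ^{m+n}`. -/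
def latticeToNQ : N m n →ₗ[ℤ] NQ m n :=
  Submodule.liftQ _
    (((Submodule.mkQ (Submodule.span ℚ {oneNegOne m n ℚ})).restrictScalars ℤ).comp
      ((Algebra.linearMap ℤ ℚ).compLeft (Fin m ⊕ Fin n)))
    (by
      rw [Submodule.span_singleton_le_iff_mem, LinearMap.mem_ker]
      have h : (Algebra.linearMap ℤ ℚ).compLeft (Fin m ⊕ Fin n) (oneNegOne m n ℤ)
          = oneNegOne m n ℚ := by
        ext v
        cases v <;> simp [oneNegOne]
      rw [LinearMap.comp_apply, h]
      exact (Submodule.Quotient.mk_eq_zero _).mpr (Submodule.mem_span_singleton_self _))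

/-- The pairing `M_ℚ × N_ℚ → ℚ` induced by the standard scalar product of `ℚ^{m+n}`. -/
def pairing : MQ m n →ₗ[ℚ] NQ m n →ₗ[ℚ] ℚ where
  toFun b := Submodule.liftQ _ (dotProductBilin ℚ ℚ b.1) (by
    rw [Submodule.span_singleton_le_iff_mem, LinearMap.mem_ker]
    exact b.2)
  map_add' b c := by
    ext
    simp
  map_smul' r b := by
    ext
    simp

/-- The vector `e^i + f^j` of `M_ℚ`. -/
def edgeRay (i : Fin m) (j : Fin n) : MQ m n :=
  ⟨Pi.single (Sum.inl i) 1 + Pi.single (Sum.inr j) 1, by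
    rw [MQ, LinearMap.mem_ker]
    simp [oneNegOne]⟩

/-- The dual edge cone `σ_G^∨`: the cone in `M_ℚ` generated by `e^i + f^j`, `(i, j) ∈ E(G)`. -/
def dualEdgeCone (G : SimpleGraph (Fin m ⊕ Fin n)) : PointedCone ℚ (MQ m n) :=
  PointedCone.hull ℚ {b | ∃ i j, G.Adj (Sum.inl i) (Sum.inr j) ∧ b = edgeRay i j}

/-- The edge cone `σ_G` in `N_ℚ`: the dual cone of `σ_G^∨`. -/
def edgeCone (G : SimpleGraph (Fin m ⊕ Fin n)) : PointedCone ℚ (NQ m n) :=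
  PointedCone.dual pairing (dualEdgeCone G : Set (MQ m n))

/-- The dimension of a cone: the dimension of the linear subspace that it spans. -/
def coneDim (τ : PointedCone ℚ (NQ m n)) : ℕ :=
  Module.finrank ℚ (Submodule.span ℚ (τ : Set (NQ m n)))

/-- The cone `τ` is generated by part of a `ℤ`-basis of the lattice `N`. -/
def GeneratedByPartOfBasis (τ : PointedCone ℚ (NQ m n)) : Prop :=
  ∃ (ι : Type) (B : Module.Basis ι ℤ (N m n)) (s : Set ι),
    τ = PointedCone.hull ℚ ((fun i => latticeToNQ (B i)) '' s)

end Cone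

end BipartiteToric

end

/-! Orient every edge from `U₁` to `U₂` and change the sign of the coordinates on `U₂`. Then `e^i +
f^j` becomes the incidence vector of an arc and `(1,-1)` becomes the constant vector, so both claims
concern the monoid generated by the incidence vectors of a connected digraph. A face of this monoid
is a set `F` of arcs cut out by a vertex weight that never increases along an arc and is constant
exactly along the arcs of `F` (`IsFaceWeight`). Its codimension is one less than the number of
vertices left after contracting `F`.

Codimension at most 2 thus leaves at most three vertices. The weight orders them, say as p, q, r,
and the surviving arcs run p → q, q → r or p → r. Connectedness forces at least two of these types.
If p → q and q → r both occur, the third type is their sum; otherwise exactly two types occur.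
Either way the arcs outside `F` are, modulo the lattice of `F`, natural combinations of at most two
arcs having dual integral functionals. This is `IsFaceWeight.exists_isDualSystem`, and both claims
rest on it.

Smoothness: for a prime of height at most 2, the coordinates outside it form a face
(`exists_isFaceWeight_of_isPrime`). A chain of face ideals bounds its number of contracted vertices
by 3 (`card_contraction_le_of_height_le`). Inverting a lattice basis of the face turns the
coordinate ring into a localization of a polynomial ring (`exists_formallySmooth_localization`).

Cone: a relative interior point of a face of `σ_G` is itself a face weight, and the dimension of the
face bounds the contraction. The dual functionals generate the face and extend to a basis of `N`
(`generatedByPartOfBasis_of_isFaceOf`). -/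

namespace BipartiteToric

/-! ### Digraphs, contracted faces, and dual systems in codimension at most two. -/

section Incidence

variable {V E : Type} (src tgt : E → V)

/-- The set of vertices obtained by contracting the edges of `F`. -/
abbrev Contraction (F : Set E) : Type :=
  Quot fun u v : V => ∃ e ∈ F, src e = u ∧ tgt e = v

/-- The class of a vertex after contracting the edges of `F`. -/
abbrev cls (F : Set E) (v : V) : Contraction src tgt F :=
  Quot.mk _ v

/-- The signed incidence vector of an edge. -/
def edgeVec [DecidableEq V] (e : E) : V → ℤ :=
  Pi.single (src e) 1 - Pi.single (tgt e) 1

/-- The lattice spanned by the incidence vectors of the edges in `F`. -/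
def edgeSpan [DecidableEq V] (F : Set E) : Submodule ℤ (V → ℤ) :=
  Submodule.span ℤ (edgeVec src tgt '' F)

/-- The functional `c` is nonnegative on all edges and vanishes precisely on the edges of `F`. -/
structure IsFaceWeight {α : Type} [LinearOrder α] (F : Set E) (c : V → α) : Prop where
  le : ∀ e, c (tgt e) ≤ c (src e)
  mem_iff : ∀ e, e ∈ F ↔ c (src e) = c (tgt e)

/-- Every function on the vertices that is constant along edges is constant. -/
def IsConnected : Prop :=
  ∀ (X : Type) (f : V → X), (∀ e, f (src e) = f (tgt e)) → ∀ u v, f u = f v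

/-- Edges `s i` that, together with `±F`, generate all edges, with functionals `φ i` that vanish
on `F` and are dual to the `s i`. -/
structure IsDualSystem [DecidableEq V] {ι : Type} [Fintype ι] [DecidableEq ι] (F : Set E)
    (s : ι → E) (φ : ι → V → ℤ) : Prop where
  eq_of_mem : ∀ i, ∀ e ∈ F, φ i (src e) = φ i (tgt e)
  dual : ∀ i j, φ i (src (s j)) - φ i (tgt (s j)) = if i = j then 1 else 0
  gen : ∀ e, ∃ b : ι → ℕ,
    edgeVec src tgt e - ∑ i, b i • edgeVec src tgt (s i) ∈ edgeSpan src tgt F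

variable {src tgt}

theorem cls_src_eq {F : Set E} {e : E} (he : e ∈ F) :
    cls src tgt F (src e) = cls src tgt F (tgt e) :=
  Quot.sound ⟨e, he, rfl, rfl⟩

section Span

variable [DecidableEq V]

/-- The class of a contracted vertex in the quotient by the contracted edges. -/
def quotVec (F : Set E) : Contraction src tgt F → (V → ℤ) ⧸ edgeSpan src tgt F :=
  Quot.lift (fun v => Submodule.Quotient.mk (Pi.single v 1)) (by
    rintro _ _ ⟨e, he, rfl, rfl⟩
    exact (Submodule.Quotient.eq _).mpr (Submodule.subset_span ⟨e, he, rfl⟩))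

theorem mk_edgeVec (F : Set E) (e : E) :
    (Submodule.Quotient.mk (edgeVec src tgt e) : (V → ℤ) ⧸ edgeSpan src tgt F) =
      quotVec F (cls src tgt F (src e)) - quotVec F (cls src tgt F (tgt e)) := by
  simp [quotVec, edgeVec]

theorem edgeVec_mem_edgeSpan {F : Set E} {e : E}
    (h : cls src tgt F (src e) = cls src tgt F (tgt e)) :
    edgeVec src tgt e ∈ edgeSpan src tgt F := by
  rw [← Submodule.Quotient.mk_eq_zero, mk_edgeVec, h, sub_self]

/-- Modulo the lattice of `F`, a unit vector depends only on the contracted class of its vertex. A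
dual system can therefore be verified on the contraction, where only two or three points remain. -/
theorem IsDualSystem.of_cls {ι : Type} [Fintype ι] [DecidableEq ι] {F : Set E}
    {s : ι → E} (ψ : ι → Contraction src tgt F → ℤ)
    (dual : ∀ i j, ψ i (cls src tgt F (src (s j))) - ψ i (cls src tgt F (tgt (s j))) =
      if i = j then 1 else 0)
    (gen : ∀ e, ∃ b : ι → ℕ,
      quotVec F (cls src tgt F (src e)) - quotVec F (cls src tgt F (tgt e)) =
        ∑ i, b i • (quotVec F (cls src tgt F (src (s i))) -
          quotVec F (cls src tgt F (tgt (s i))))) :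
    IsDualSystem src tgt F s (fun i v => ψ i (cls src tgt F v)) where
  eq_of_mem i e he := by rw [cls_src_eq he]
  dual := dual
  gen e := by
    obtain ⟨b, hb⟩ := gen e
    refine ⟨b, ?_⟩
    rw [← Submodule.Quotient.mk_eq_zero, Submodule.Quotient.mk_sub, mk_edgeVec, hb, sub_eq_zero]
    simp only [← mk_edgeVec]
    exact (map_sum (Submodule.mkQ (edgeSpan src tgt F)) _ _).symm

end Span

section Core

variable {α : Type} [LinearOrder α] {F : Set E} {c : V → α}

/-- A face weight as a function on the contracted vertices. -/
def IsFaceWeight.lift (hc : IsFaceWeight src tgt F c) : Contraction src tgt F → α :=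
  Quot.lift c (by rintro _ _ ⟨e, he, rfl, rfl⟩; exact (hc.mem_iff e).mp he)

theorem IsFaceWeight.lift_lt (hc : IsFaceWeight src tgt F c) {e : E}
    (he : cls src tgt F (src e) ≠ cls src tgt F (tgt e)) :
    hc.lift (cls src tgt F (tgt e)) < hc.lift (cls src tgt F (src e)) := by
  refine lt_of_le_of_ne (hc.le e) fun h => he (cls_src_eq ((hc.mem_iff e).mpr h.symm))

/-- Otherwise membership in the class `p` would be a non-constant function that is constant along
edges. -/
theorem IsConnected.exists_edge (hconn : IsConnected src tgt) {p q : Contraction src tgt F}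
    (hpq : p ≠ q) : ∃ e, ¬(cls src tgt F (src e) = p ↔ cls src tgt F (tgt e) = p) := by
  by_contra! h
  obtain ⟨u, rfl⟩ := Quot.exists_rep p
  obtain ⟨v, rfl⟩ := Quot.exists_rep q
  have := hconn Prop (fun w => cls src tgt F w = Quot.mk _ u) (fun e => propext (h e)) u v
  exact hpq (this.mp rfl).symm

theorem exists_isDualSystem_of_two [DecidableEq V] (hconn : IsConnected src tgt)
    (hc : IsFaceWeight src tgt F c) {p r : Contraction src tgt F} (hpr : p ≠ r)
    (hle : hc.lift r ≤ hc.lift p) (hall : ∀ x, x = p ∨ x = r) :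
    ∃ (l : ℕ) (s : Fin l → E) (φ : Fin l → V → ℤ), IsDualSystem src tgt F s φ := by
  classical
  have hE : ∀ e, cls src tgt F (src e) = cls src tgt F (tgt e) ∨
      (cls src tgt F (src e) = p ∧ cls src tgt F (tgt e) = r) := by
    intro e
    by_cases h : cls src tgt F (src e) = cls src tgt F (tgt e)
    · exact .inl h
    have h' := hc.lift_lt h
    rcases hall (cls src tgt F (src e)) with h1 | h1 <;>
    rcases hall (cls src tgt F (tgt e)) with h2 | h2 <;> rw [h1, h2] at h' h <;>
    first
    | exact absurd rfl h
    | exact absurd h' (not_lt.mpr hle)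
    | simp [h1, h2]
  obtain ⟨e₁, he₁⟩ := hconn.exists_edge hpr
  have he₁' : cls src tgt F (src e₁) = p ∧ cls src tgt F (tgt e₁) = r := by grind
  refine ⟨1, ![e₁], _, IsDualSystem.of_cls ![fun x => if x = p then 1 else 0] ?_ ?_⟩
  · simp [Fin.forall_fin_one, he₁', hpr.symm]
  · intro e
    rcases hE e with h | ⟨h, h'⟩
    · exact ⟨![0], by simp [h]⟩
    · exact ⟨![1], by simp [h, h', he₁']⟩

/-- The weak inequalities suffice: an edge that is not a loop after contraction strictly lowers the
weight, so edges can only go forward in the order p, q, r. Each class meets such an edge, which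
forces two of the three possible types to occur. -/
theorem exists_isDualSystem_of_three [DecidableEq V] (hconn : IsConnected src tgt)
    (hc : IsFaceWeight src tgt F c) {p q r : Contraction src tgt F} (hpq : p ≠ q) (hqr : q ≠ r)
    (hpr : p ≠ r) (hle : hc.lift q ≤ hc.lift p) (hle' : hc.lift r ≤ hc.lift q)
    (hall : ∀ x, x = p ∨ x = q ∨ x = r) :
    ∃ (l : ℕ) (s : Fin l → E) (φ : Fin l → V → ℤ), IsDualSystem src tgt F s φ := by
  classical
  have hE : ∀ e, cls src tgt F (src e) = cls src tgt F (tgt e) ∨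
      (cls src tgt F (src e) = p ∧ cls src tgt F (tgt e) = q) ∨
      (cls src tgt F (src e) = q ∧ cls src tgt F (tgt e) = r) ∨
      (cls src tgt F (src e) = p ∧ cls src tgt F (tgt e) = r) := by
    intro e
    by_cases h : cls src tgt F (src e) = cls src tgt F (tgt e)
    · exact .inl h
    have h' := hc.lift_lt h
    rcases hall (cls src tgt F (src e)) with h1 | h1 | h1 <;>
    rcases hall (cls src tgt F (tgt e)) with h2 | h2 | h2 <;> rw [h1, h2] at h' h <;>
    first
    | exact absurd rfl h
    | exact absurd h' (not_lt.mpr (by first | exact hle | exact hle' | exact hle'.trans hle))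
    | simp [h1, h2]
  obtain ⟨ep, hep⟩ := hconn.exists_edge hpq
  obtain ⟨eq, heq⟩ := hconn.exists_edge hqr
  obtain ⟨er, her⟩ := hconn.exists_edge hpr.symm
  have key : ∀ (e₁ e₂ : E) (ψ₁ ψ₂ : Contraction src tgt F → ℤ),
      ψ₁ (cls src tgt F (src e₁)) - ψ₁ (cls src tgt F (tgt e₁)) = 1 →
      ψ₁ (cls src tgt F (src e₂)) - ψ₁ (cls src tgt F (tgt e₂)) = 0 →
      ψ₂ (cls src tgt F (src e₁)) - ψ₂ (cls src tgt F (tgt e₁)) = 0 →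
      ψ₂ (cls src tgt F (src e₂)) - ψ₂ (cls src tgt F (tgt e₂)) = 1 →
      (∀ e, ∃ b₁ b₂ : ℕ,
        quotVec F (cls src tgt F (src e)) - quotVec F (cls src tgt F (tgt e)) =
        b₁ • (quotVec F (cls src tgt F (src e₁)) - quotVec F (cls src tgt F (tgt e₁))) +
        b₂ • (quotVec F (cls src tgt F (src e₂)) - quotVec F (cls src tgt F (tgt e₂)))) →
      ∃ (l : ℕ) (s : Fin l → E) (φ : Fin l → V → ℤ), IsDualSystem src tgt F s φ := by
    intro e₁ e₂ ψ₁ ψ₂ h11 h12 h21 h22 hgen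
    refine ⟨2, ![e₁, e₂], _, IsDualSystem.of_cls ![ψ₁, ψ₂] ?_ ?_⟩
    · simp [Fin.forall_fin_two, h11, h12, h21, h22]
    · intro e
      obtain ⟨b₁, b₂, h⟩ := hgen e
      exact ⟨![b₁, b₂], by simpa using h⟩
  -- The generators are pq and qr if both occur, with pr as their sum; otherwise they are the only
  -- two types that occur.
  by_cases h1 : ∃ e, cls src tgt F (src e) = p ∧ cls src tgt F (tgt e) = q
  · obtain ⟨e₁, h1s, h1t⟩ := h1
    by_cases h2 : ∃ e, cls src tgt F (src e) = q ∧ cls src tgt F (tgt e) = r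
    · obtain ⟨e₂, h2s, h2t⟩ := h2
      refine key e₁ e₂ (fun x => if x = p then 1 else 0) (fun x => if x = r then -1 else 0)
        ?_ ?_ ?_ ?_ ?_
      iterate 4 simp [h1s, h1t, h2s, h2t, hpr, hqr, hpq.symm, hpr.symm]
      intro e
      rw [h1s, h1t, h2s, h2t]
      rcases hE e with h | ⟨h, h'⟩ | ⟨h, h'⟩ | ⟨h, h'⟩
      · exact ⟨0, 0, by simp [h]⟩
      · exact ⟨1, 0, by simp [h, h']⟩
      · exact ⟨0, 1, by simp [h, h']⟩
      · exact ⟨1, 1, by simp [h, h']⟩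
    · have h3 : ∃ e, cls src tgt F (src e) = p ∧ cls src tgt F (tgt e) = r := by
        refine ⟨er, ?_⟩
        grind
      obtain ⟨e₂, h2s, h2t⟩ := h3
      refine key e₁ e₂ (fun x => if x = q then -1 else 0) (fun x => if x = r then -1 else 0)
        ?_ ?_ ?_ ?_ ?_
      iterate 4 simp [h1s, h1t, h2s, h2t, hpq, hpr, hqr, hqr.symm]
      intro e
      rw [h1s, h1t, h2s, h2t]
      rcases hE e with h | ⟨h, h'⟩ | ⟨h, h'⟩ | ⟨h, h'⟩
      · exact ⟨0, 0, by simp [h]⟩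
      · exact ⟨1, 0, by simp [h, h']⟩
      · exact absurd ⟨e, h, h'⟩ h2
      · exact ⟨0, 1, by simp [h, h']⟩
  · have h3 : ∃ e, cls src tgt F (src e) = p ∧ cls src tgt F (tgt e) = r := by
      refine ⟨ep, ?_⟩
      grind
    have h4 : ∃ e, cls src tgt F (src e) = q ∧ cls src tgt F (tgt e) = r := by
      refine ⟨eq, ?_⟩
      grind
    obtain ⟨e₁, h1s, h1t⟩ := h3
    obtain ⟨e₂, h2s, h2t⟩ := h4
    refine key e₁ e₂ (fun x => if x = p then 1 else 0) (fun x => if x = q then 1 else 0)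
      ?_ ?_ ?_ ?_ ?_
    iterate 4 simp [h1s, h1t, h2s, h2t, hpq, hpq.symm, hpr.symm, hqr.symm]
    intro e
    rw [h1s, h1t, h2s, h2t]
    rcases hE e with h | ⟨h, h'⟩ | ⟨h, h'⟩ | ⟨h, h'⟩
    · exact ⟨0, 0, by simp [h]⟩
    · exact absurd ⟨e, h, h'⟩ h1
    · exact ⟨0, 1, by simp [h, h']⟩
    · exact ⟨1, 0, by simp [h, h']⟩

/-- A face whose contraction has at most three vertices is simplicial and unimodular. -/
theorem IsFaceWeight.exists_isDualSystem [DecidableEq V] [Finite V]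
    (hconn : IsConnected src tgt) (hc : IsFaceWeight src tgt F c)
    (hcard : Nat.card (Contraction src tgt F) ≤ 3) :
    ∃ (l : ℕ) (s : Fin l → E) (φ : Fin l → V → ℤ), IsDualSystem src tgt F s φ := by
  classical
  have : Finite (Contraction src tgt F) := Quot.finite _
  by_cases hsub : Subsingleton (Contraction src tgt F)
  · refine ⟨0, Fin.elim0, _, IsDualSystem.of_cls Fin.elim0 (fun i => i.elim0) fun e => ⟨0, ?_⟩⟩
    simp [Subsingleton.elim (cls src tgt F (src e)) (cls src tgt F (tgt e))]
  rw [not_subsingleton_iff_nontrivial] at hsub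
  have h2 := Finite.one_lt_card (α := Contraction src tgt F)
  obtain h | h : Nat.card (Contraction src tgt F) = 2 ∨ Nat.card (Contraction src tgt F) = 3 := by
    omega
  · obtain ⟨p, r, hpr, hall⟩ := Nat.card_eq_two_iff.mp h
    have hall' : ∀ x, x = p ∨ x = r := fun x => by
      have := hall.symm ▸ Set.mem_univ x
      simpa using this
    rcases le_total (hc.lift r) (hc.lift p) with hle | hle
    · exact exists_isDualSystem_of_two hconn hc hpr hle hall'
    · exact exists_isDualSystem_of_two hconn hc hpr.symm hle fun x => (hall' x).symm
  · have : Fintype (Contraction src tgt F) := Fintype.ofFinite _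
    rw [Nat.card_eq_fintype_card, ← Finset.card_univ, Finset.card_eq_three] at h
    obtain ⟨x, y, z, hxy, hxz, hyz, hall⟩ := h
    have hall' : ∀ t, t = x ∨ t = y ∨ t = z := fun t => by
      have := hall ▸ Finset.mem_univ t
      simpa using this
    rcases le_total (hc.lift x) (hc.lift y) with h1 | h1 <;>
    rcases le_total (hc.lift y) (hc.lift z) with h2 | h2 <;>
    rcases le_total (hc.lift x) (hc.lift z) with h3 | h3
    · exact exists_isDualSystem_of_three hconn hc hyz.symm hxy.symm hxz.symm h2 h1 (fun t => by have := hall' t; tauto)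
    · exact exists_isDualSystem_of_three hconn hc hyz.symm hxy.symm hxz.symm h2 h1 (fun t => by have := hall' t; tauto)
    · exact exists_isDualSystem_of_three hconn hc hyz hxz.symm hxy.symm h2 h3 (fun t => by have := hall' t; tauto)
    · exact exists_isDualSystem_of_three hconn hc hxy.symm hxz hyz h1 h3 (fun t => by have := hall' t; tauto)
    · exact exists_isDualSystem_of_three hconn hc hxz.symm hxy hyz.symm h3 h1 (fun t => by have := hall' t; tauto)
    · exact exists_isDualSystem_of_three hconn hc hxz hyz.symm hxy h3 h2 (fun t => by have := hall' t; tauto)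
    · exact exists_isDualSystem_of_three hconn hc hxy hyz hxz h1 h2 (fun t => by have := hall' t; tauto)
    · exact exists_isDualSystem_of_three hconn hc hxy hyz hxz h1 h2 (fun t => by have := hall' t; tauto)

end Core

end Incidence

end BipartiteToric

namespace BipartiteToric

/-! ### Lattice bases of faces, larger faces, and recognition of faces. -/

section Incidence

variable {V E : Type} {src tgt : E → V}

theorem dotProduct_edgeVec [DecidableEq V] [Fintype V] (φ : V → ℤ) (e : E) :
    φ ⬝ᵥ edgeVec src tgt e = φ (src e) - φ (tgt e) := by
  simp [edgeVec, dotProduct_sub]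

/-- Vectors with dual functionals that vanish on an independent family extend it. -/
theorem linearIndependent_sumElim_of_dual {M κ ι : Type} [AddCommGroup M] [DecidableEq ι]
    {v : κ → M} (hv : LinearIndependent ℤ v) (w : ι → M) (φ : ι → M →ₗ[ℤ] ℤ)
    (hφv : ∀ i k, φ i (v k) = 0) (hφw : ∀ i j, φ i (w j) = if i = j then 1 else 0) :
    LinearIndependent ℤ (Sum.elim v w) := by
  rw [linearIndependent_iff'] at hv ⊢
  have key : ∀ (s : Finset (κ ⊕ ι)) (g : κ ⊕ ι → ℤ), ∑ x ∈ s, g x • Sum.elim v w x = 0 →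
      ∀ i, Sum.inr i ∈ s → g (Sum.inr i) = 0 := by
    intro s g hg i hi
    have h := congrArg (φ i) hg
    rw [map_sum, map_zero, Finset.sum_eq_single (Sum.inr i)] at h
    · simpa [hφw] using h
    · rintro (k | j) _ hne
      · simp [hφv]
      · have : i ≠ j := fun h => hne (h ▸ rfl)
        simp [hφw, this]
    · exact fun h => absurd hi h
  rintro s g hg (k | i) hx
  · refine hv (s.toLeft) (fun k => g (Sum.inl k)) ?_ k (by simpa using hx)
    rw [← hg]
    conv_rhs => rw [← Finset.toLeft_disjSum_toRight (u := s), Finset.sum_disjSum]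
    rw [Finset.sum_eq_zero (s := s.toRight), add_zero]
    · simp
    · intro j hj
      rw [key s g hg j (by simpa using hj), zero_smul]
  · exact key s g hg i hx

/-- The edges of `F` contain a basis of the lattice that they span. -/
theorem exists_linearIndependent_edgeSpan [DecidableEq V] [Finite V] {F : Set E}
    (hF : F.Finite) :
    ∃ (κ : Type) (_ : Fintype κ) (t : κ → E), (∀ k, t k ∈ F) ∧
      LinearIndependent ℤ (fun k => edgeVec src tgt (t k)) ∧
      edgeSpan src tgt F = Submodule.span ℤ (Set.range fun k => edgeVec src tgt (t k)) := by
  classical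
  have := Fintype.ofFinite V
  induction F, hF using Set.Finite.induction_on with
  | empty =>
    exact ⟨Empty, inferInstance, Empty.elim, fun k => k.elim, linearIndependent_empty_type,
      by rw [Set.range_eq_empty, edgeSpan, Set.image_empty]⟩
  | @insert a F _ _ ih =>
    obtain ⟨κ, _, t, ht, hli, hspan⟩ := ih
    by_cases h : cls src tgt F (src a) = cls src tgt F (tgt a)
    · refine ⟨κ, inferInstance, t, fun k => .inr (ht k), hli, ?_⟩
      rw [← hspan, edgeSpan, Set.image_insert_eq]
      exact Submodule.span_insert_eq_span (edgeVec_mem_edgeSpan h)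
    · refine ⟨κ ⊕ Unit, inferInstance, Sum.elim t fun _ => a, ?_, ?_, ?_⟩
      · rintro (k | _)
        exacts [.inr (ht k), .inl rfl]
      -- The indicator of the contracted class of `src a` vanishes on `F` and takes the value 1 on
      -- `a`.
      · have := linearIndependent_sumElim_of_dual hli (fun _ : Unit => edgeVec src tgt a)
          (fun _ => dotProductBilin ℤ ℤ
            (fun v => if cls src tgt F v = cls src tgt F (src a) then 1 else 0))
          (fun _ k => ?_) (fun _ _ => ?_)
        · rwa [show (fun k => edgeVec src tgt (Sum.elim t (fun _ : Unit => a) k)) = Sum.elim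
            (fun k => edgeVec src tgt (t k)) (fun _ => edgeVec src tgt a) by ext (k | _) <;> rfl]
        · have hk := cls_src_eq (src := src) (tgt := tgt) (ht k)
          simp [dotProduct_edgeVec, hk]
        · simp [dotProduct_edgeVec, Ne.symm h]
      · rw [edgeSpan, Set.image_insert_eq, Submodule.span_insert, ← edgeSpan, hspan,
          ← Submodule.span_union]
        congr 1
        ext x
        simp [or_comm, eq_comm]

/-- Merging the endpoints of a shortest edge outside of a proper face yields a larger face. -/
theorem IsFaceWeight.exists_larger [Finite V] [Finite E] (hconn : IsConnected src tgt)
    {F : Set E} {c : V → ℤ} (hc : IsFaceWeight src tgt F c)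
    (hcard : 2 ≤ Nat.card (Contraction src tgt F)) :
    ∃ (F' : Set E) (c' : V → ℤ), IsFaceWeight src tgt F' c' ∧ F ⊂ F' ∧
      Nat.card (Contraction src tgt F) ≤ Nat.card (Contraction src tgt F') + 1 := by
  classical
  have : Finite (Contraction src tgt F) := Quot.finite _
  have hne : ({e | e ∉ F} : Set E).Nonempty := by
    by_contra h
    rw [Set.not_nonempty_iff_eq_empty, Set.eq_empty_iff_forall_notMem] at h
    have : Subsingleton (Contraction src tgt F) := ⟨fun p q => by
      obtain ⟨u, rfl⟩ := Quot.exists_rep p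
      obtain ⟨v, rfl⟩ := Quot.exists_rep q
      exact hconn _ (cls src tgt F) (fun e => cls_src_eq (not_not.mp (h e))) u v⟩
    have := Finite.card_le_one_iff_subsingleton.mpr this
    omega
  obtain ⟨e₀, he₀, hmin⟩ := Set.exists_min_image _ (fun e => c (src e) - c (tgt e))
    (Set.toFinite _) hne
  have hlt : ∀ e, e ∉ F → c (tgt e) < c (src e) := fun e he =>
    lt_of_le_of_ne (hc.le e) fun h => he ((hc.mem_iff e).mpr h.symm)
  set p := cls src tgt F (src e₀) with hp
  set q := cls src tgt F (tgt e₀) with hq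
  have hlift : ∀ v, hc.lift (cls src tgt F v) = c v := fun v => rfl
  have hcp : ∀ v, cls src tgt F v = p → c v = c (src e₀) := fun v hv => by
    rw [← hlift, hv, hp, hlift]
  have hcq : ∀ v, cls src tgt F v = q → c v = c (tgt e₀) := fun v hv => by
    rw [← hlift, hv, hq, hlift]
  have hpq : q ≠ p := fun h => (hlt e₀ he₀).ne (hcp _ h)
  -- The classes `p` and `q` move to the midpoint of their weights; all weights are doubled to keep
  -- it integral.
  let c' : V → ℤ := fun v =>
    if cls src tgt F v = p ∨ cls src tgt F v = q then c (src e₀) + c (tgt e₀) else 2 * c v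
  have hF : ∀ e ∈ F, c' (src e) = c' (tgt e) := fun e he => by
    simp only [c']
    rw [cls_src_eq he, (hc.mem_iff e).mp he]
  -- Minimality of `e₀` matters for edges leaving `p` or entering `q`: they are at least as long as
  -- `e₀`, so moving their endpoint by half of that length leaves them strictly decreasing.
  have hnF : ∀ e, e ∉ F → (cls src tgt F (src e) = p ∧ cls src tgt F (tgt e) = q ∧
      c' (src e) = c' (tgt e)) ∨ c' (tgt e) < c' (src e) := fun e he => by
    have h0 := hlt e₀ he₀
    have h1 := hlt e he
    have h2 := hmin e he
    have h3 := hcp (src e)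
    have h4 := hcp (tgt e)
    have h5 := hcq (src e)
    have h6 := hcq (tgt e)
    by_cases a1 : cls src tgt F (src e) = p <;> by_cases a2 : cls src tgt F (src e) = q <;>
    by_cases a3 : cls src tgt F (tgt e) = p <;> by_cases a4 : cls src tgt F (tgt e) = q <;>
    simp only [c', a1, a2, a3, a4, true_or, or_true, or_self, if_true, if_false, true_and,
      false_and, false_or, true_imp_iff, hpq, hpq.symm] at * <;> omega
  refine ⟨{e | c' (src e) = c' (tgt e)}, c', ⟨fun e => ?_, fun e => Iff.rfl⟩, ?_, ?_⟩
  · by_cases he : e ∈ F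
    · exact (hF e he).ge
    · rcases hnF e he with h | h
      exacts [h.2.2.ge, h.le]
  · refine ⟨hF, fun h => he₀ (h ?_)⟩
    change c' (src e₀) = c' (tgt e₀)
    simp only [c']
    rw [if_pos (.inl rfl), if_pos (.inr rfl)]
  -- Sending `p` to `q` maps the new contraction onto the old one without `p`, so at most one vertex
  -- is lost.
  · let h : Contraction src tgt {e | c' (src e) = c' (tgt e)} → {x : Contraction src tgt F // x ≠ p} :=
      Quot.lift (fun v => if hv : cls src tgt F v = p then ⟨q, hpq⟩ else ⟨cls src tgt F v, hv⟩) (by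
        rintro _ _ ⟨e, he, rfl, rfl⟩
        by_cases heF : e ∈ F
        · have hs := cls_src_eq (src := src) (tgt := tgt) heF
          by_cases hv : cls src tgt F (tgt e) = p
          · rw [dif_pos (hs.trans hv), dif_pos hv]
          · rw [dif_neg (by rwa [hs]), dif_neg hv]
            exact Subtype.ext hs
        · rcases hnF e heF with ⟨h1, h2, -⟩ | h
          · rw [dif_pos h1, dif_neg (by rw [h2]; exact hpq)]
            exact Subtype.ext h2.symm
          · exact absurd he h.ne')
    have hs : Function.Surjective h := by
      rintro ⟨x, hx⟩
      obtain ⟨v, rfl⟩ := Quot.exists_rep x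
      exact ⟨Quot.mk _ v, dif_neg hx⟩
    have : Finite (Contraction src tgt {e | c' (src e) = c' (tgt e)}) := Quot.finite _
    have h1 := Nat.card_le_card_of_surjective h hs
    have h2 : Nat.card {x : Contraction src tgt F // x ≠ p} + 1 =
        Nat.card (Contraction src tgt F) := by
      have := Fintype.ofFinite (Contraction src tgt F)
      rw [Nat.card_eq_fintype_card, Nat.card_eq_fintype_card, Fintype.card_subtype_compl,
        Fintype.card_subtype_eq]
      have : 0 < Fintype.card (Contraction src tgt F) := Fintype.card_pos_iff.mpr ⟨p⟩
      omega
    omega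

/-- A set of edges that contains all summands of its elements is cut out by a functional. -/
theorem exists_isFaceWeight [DecidableEq V] [Finite V] {F : Set E}
    (hF : ∀ (e : E) (b b' : E →₀ ℕ), (∀ f ∈ b'.support, f ∈ F) →
      edgeVec src tgt e + Finsupp.linearCombination ℕ (edgeVec src tgt) b =
        Finsupp.linearCombination ℕ (edgeVec src tgt) b' → e ∈ F) :
    ∃ c : V → ℤ, IsFaceWeight src tgt F c := by
  classical
  let θ := Finsupp.linearCombination ℕ (edgeVec src tgt)
  -- `C v w` says that the difference of unit vectors lies in the edge monoid with the edges of `F`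
  -- inverted. This is a preorder, and an edge is reversible in it exactly when it belongs to `F`.
  let C : V → V → Prop := fun v w => ∃ b b' : E →₀ ℕ, (∀ f ∈ b'.support, f ∈ F) ∧
    (Pi.single v 1 - Pi.single w 1 : V → ℤ) = θ b - θ b'
  have hrefl : ∀ v, C v v := fun v => ⟨0, 0, by simp, by simp⟩
  have htrans : ∀ {u v w}, C u v → C v w → C u w := by
    rintro u v w ⟨b₁, b₁', h1, h1'⟩ ⟨b₂, b₂', h2, h2'⟩
    refine ⟨b₁ + b₂, b₁' + b₂', fun f hf => ?_, ?_⟩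
    · rcases Finset.mem_union.mp (Finsupp.support_add hf) with h | h
      exacts [h1 f h, h2 f h]
    · rw [map_add, map_add, add_sub_add_comm, ← h1', ← h2']
      abel
  have hE : ∀ e, C (src e) (tgt e) := fun e =>
    ⟨Finsupp.single e 1, 0, by simp, by simp [θ, edgeVec]⟩
  have hEF : ∀ e, e ∈ F ↔ C (tgt e) (src e) := by
    refine fun e => ⟨fun he => ⟨0, Finsupp.single e 1, ?_, by simp [θ, edgeVec]⟩, ?_⟩
    · intro f hf
      obtain rfl : f = e := by simpa using Finsupp.support_single_subset hf
      exact he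
    · rintro ⟨b, b', hb, h⟩
      refine hF e b b' hb ?_
      rw [edgeVec, ← neg_sub, h]
      simp [θ]
  have hsub : ∀ {u v}, C u v → {w | C v w} ⊆ {w | C u w} := fun h w hw => htrans h hw
  -- The weight of a vertex counts the vertices below it. Down-sets shrink along edges, and equal
  -- cardinality forces equal down-sets, hence reversibility.
  refine ⟨fun v => ({w | C v w}.ncard : ℤ), fun e => ?_, fun e => ⟨fun he => ?_, fun he => ?_⟩⟩
  · exact_mod_cast Set.ncard_le_ncard (hsub (hE e)) (Set.toFinite _)
  · have := (hsub (hE e)).antisymm (hsub ((hEF e).mp he))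
    simp only [this]
  · have := Set.eq_of_subset_of_ncard_le (hsub (hE e)) (by exact_mod_cast he.le) (Set.toFinite _)
    rw [hEF]
    exact this.symm.le (hrefl (src e))

end Incidence

end BipartiteToric

namespace BipartiteToric

section Incidence

variable {V E : Type} {src tgt : E → V}

/-- Evaluate a functional that vanishes on `F` through a dual system. -/
theorem IsDualSystem.exists_sub_eq [DecidableEq V] [Fintype V] {ι : Type} [Fintype ι]
    [DecidableEq ι] {F : Set E} {s : ι → E} {φ : ι → V → ℤ} (h : IsDualSystem src tgt F s φ)
    (e : E) : ∃ b : ι → ℕ, ∀ {A : Type} [AddCommGroup A] (ψ : V → A),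
      (∀ f ∈ F, ψ (src f) = ψ (tgt f)) →
        ψ (src e) - ψ (tgt e) = ∑ i, b i • (ψ (src (s i)) - ψ (tgt (s i))) := by
  obtain ⟨b, hb⟩ := h.gen e
  refine ⟨b, fun {A} _ ψ hψ => ?_⟩
  let L := Fintype.linearCombination ℤ ψ
  have hL : ∀ e, L (edgeVec src tgt e) = ψ (src e) - ψ (tgt e) := fun e => by
    rw [edgeVec, map_sub, Fintype.linearCombination_apply_single,
      Fintype.linearCombination_apply_single, one_smul, one_smul]
  have hker : edgeSpan src tgt F ≤ LinearMap.ker L := by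
    rw [edgeSpan, Submodule.span_le]
    rintro _ ⟨f, hf, rfl⟩
    rw [SetLike.mem_coe, LinearMap.mem_ker, hL, hψ f hf, sub_self]
  have h0 := LinearMap.mem_ker.mp (hker hb)
  rw [map_sub, hL, map_sum, sub_eq_zero] at h0
  simpa only [map_nsmul, hL] using h0

end Incidence

/-! ### Signed coordinates on `N` and extension to lattice bases. -/

section Cone

variable {m n : ℕ}

/-- The involution that changes the sign of the coordinates in `Fin n`. -/
def flipSign (R : Type) [CommRing R] : (Fin m ⊕ Fin n → R) →ₗ[R] (Fin m ⊕ Fin n → R) where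
  toFun φ := Sum.elim (fun i => φ (Sum.inl i)) (fun j => -φ (Sum.inr j))
  map_add' φ ψ := by ext (i | j) <;> simp [add_comm]
  map_smul' r φ := by ext (i | j) <;> simp

@[simp]
theorem flipSign_inl (R : Type) [CommRing R] (φ : Fin m ⊕ Fin n → R) (i : Fin m) :
    flipSign R φ (Sum.inl i) = φ (Sum.inl i) := rfl

@[simp]
theorem flipSign_inr (R : Type) [CommRing R] (φ : Fin m ⊕ Fin n → R) (j : Fin n) :
    flipSign R φ (Sum.inr j) = -φ (Sum.inr j) := rfl

theorem flipSign_flipSign (R : Type) [CommRing R] (φ : Fin m ⊕ Fin n → R) :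
    flipSign R (flipSign R φ) = φ := by
  ext (i | j) <;> simp

theorem flipSign_const (R : Type) [CommRing R] (r : R) :
    flipSign R (fun _ : Fin m ⊕ Fin n => r) = r • oneNegOne m n R := by
  ext (i | j) <;> simp [oneNegOne]

/-- The point of `N_ℚ` given by a function on the vertices, in signed coordinates. -/
def toNQ : (Fin m ⊕ Fin n → ℚ) →ₗ[ℚ] NQ m n :=
  (Submodule.mkQ _).comp (flipSign ℚ)

/-- The point of `N` given by a function on the vertices, in signed coordinates. -/
def toN : (Fin m ⊕ Fin n → ℤ) →ₗ[ℤ] N m n :=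
  (Submodule.mkQ _).comp (flipSign ℤ)

theorem toNQ_surjective : Function.Surjective (toNQ (m := m) (n := n)) := fun y => by
  obtain ⟨φ, rfl⟩ := Submodule.mkQ_surjective _ y
  exact ⟨flipSign ℚ φ, by simp [toNQ, flipSign_flipSign]⟩

theorem toN_surjective : Function.Surjective (toN (m := m) (n := n)) := fun y => by
  obtain ⟨φ, rfl⟩ := Submodule.mkQ_surjective _ y
  exact ⟨flipSign ℤ φ, by simp [toN, flipSign_flipSign]⟩

theorem toNQ_const (r : ℚ) : toNQ (fun _ : Fin m ⊕ Fin n => r) = 0 := by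
  rw [toNQ, LinearMap.comp_apply, flipSign_const, Submodule.mkQ_apply,
    Submodule.Quotient.mk_eq_zero]
  exact Submodule.smul_mem _ _ (Submodule.mem_span_singleton_self _)

theorem toN_const (r : ℤ) : toN (fun _ : Fin m ⊕ Fin n => r) = 0 := by
  rw [toN, LinearMap.comp_apply, flipSign_const, Submodule.mkQ_apply,
    Submodule.Quotient.mk_eq_zero]
  exact Submodule.smul_mem _ _ (Submodule.mem_span_singleton_self _)

theorem exists_eq_const_of_toNQ_eq_zero {φ : Fin m ⊕ Fin n → ℚ} (h : toNQ φ = 0) :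
    ∃ r, φ = fun _ => r := by
  rw [toNQ, LinearMap.comp_apply, Submodule.mkQ_apply, Submodule.Quotient.mk_eq_zero,
    Submodule.mem_span_singleton] at h
  obtain ⟨r, h⟩ := h
  refine ⟨r, ?_⟩
  rw [← flipSign_flipSign ℚ φ, ← h, ← flipSign_const, flipSign_flipSign]

theorem latticeToNQ_toN (φ : Fin m ⊕ Fin n → ℤ) :
    latticeToNQ (toN φ) = toNQ fun v => (φ v : ℚ) := by
  simp only [latticeToNQ, toN, toNQ, LinearMap.comp_apply, Submodule.mkQ_apply,
    Submodule.liftQ_apply, LinearMap.restrictScalars_apply]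
  congr 1
  ext (i | j) <;> simp

/-- The value of `e^i + f^j` on `N_ℚ`. -/
theorem pairing_edgeRay_toNQ (i : Fin m) (j : Fin n) (φ : Fin m ⊕ Fin n → ℚ) :
    pairing (edgeRay i j) (toNQ φ) = φ (Sum.inl i) - φ (Sum.inr j) := by
  simp [pairing, toNQ, edgeRay, sub_eq_add_neg]

/-- The value of `e^i + f^j` on `N`. -/
def latticePairing (i : Fin m) (j : Fin n) : N m n →ₗ[ℤ] ℤ :=
  Submodule.liftQ _
    (dotProductBilin ℤ ℤ (Pi.single (Sum.inl i) 1 + Pi.single (Sum.inr j) 1)) (by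
    rw [Submodule.span_singleton_le_iff_mem, LinearMap.mem_ker]
    simp [oneNegOne])

theorem latticePairing_toN (i : Fin m) (j : Fin n) (φ : Fin m ⊕ Fin n → ℤ) :
    latticePairing i j (toN φ) = φ (Sum.inl i) - φ (Sum.inr j) := by
  simp [latticePairing, toN, sub_eq_add_neg]

variable {E : Type} {a : E → Fin m} {b : E → Fin n}

theorem eq_zero_of_latticePairing
    (hconn : IsConnected (fun e => Sum.inl (a e)) (fun e => Sum.inr (b e))) {y : N m n}
    (hy : ∀ e, latticePairing (a e) (b e) y = 0) : y = 0 := by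
  obtain ⟨φ, rfl⟩ := toN_surjective y
  simp only [latticePairing_toN, sub_eq_zero] at hy
  have hφ := hconn _ φ hy
  rcases isEmpty_or_nonempty (Fin m ⊕ Fin n) with h | ⟨⟨v⟩⟩
  · rw [Subsingleton.elim φ 0, map_zero]
  · rw [show φ = fun _ => φ v from funext fun u => hφ u v, toN_const]

/-- Lattice vectors that admit a dual system of edges are part of a basis. -/
theorem exists_basis_extending [Finite E] {ι : Type} [Fintype ι] [DecidableEq ι]
    (hconn : IsConnected (fun e => Sum.inl (a e)) (fun e => Sum.inr (b e)))
    (s : ι → E) (y : ι → N m n)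
    (hy : ∀ i j, latticePairing (a (s j)) (b (s j)) (y i) = if i = j then 1 else 0) :
    ∃ (κ : Type) (B : Module.Basis (κ ⊕ ι) ℤ (N m n)), ∀ i, B (Sum.inr i) = y i := by
  let L : N m n →ₗ[ℤ] (ι → ℤ) := LinearMap.pi fun j => latticePairing (a (s j)) (b (s j))
  let Y : (ι → ℤ) →ₗ[ℤ] N m n := Fintype.linearCombination ℤ y
  have hLY : ∀ c, L (Y c) = c := fun c => by
    ext j
    simp [L, Y, Fintype.linearCombination_apply, hy]
  -- By connectedness the edge functionals separate the points of `N`. The kernel of `L` thus embeds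
  -- in a free `ℤ`-module of finite rank and is free; `Y` splits `L`, so a basis of the kernel
  -- completes the `y i`.
  let J : LinearMap.ker L →ₗ[ℤ] (E → ℤ) :=
    (LinearMap.pi fun e => latticePairing (a e) (b e)).comp (LinearMap.ker L).subtype
  have hJ : Function.Injective J := by
    rw [← LinearMap.ker_eq_bot, LinearMap.ker_eq_bot']
    intro x hx
    exact Subtype.ext (eq_zero_of_latticePairing hconn fun e => congrFun hx e)
  have : Module.Free ℤ (LinearMap.ker L) :=
    Module.Free.of_equiv (LinearEquiv.ofInjective J hJ).symm
  let e : (LinearMap.ker L × (ι → ℤ)) ≃ₗ[ℤ] N m n :=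
    LinearEquiv.ofLinearMap ((LinearMap.ker L).subtype.coprod Y)
      (LinearMap.prod (LinearMap.codRestrict _ (LinearMap.id - Y.comp L) fun x => by
        simp [hLY]) L)
      (by ext x; simp) (by
        refine LinearMap.ext fun ⟨x, c⟩ => ?_
        have hx : L x = 0 := x.2
        refine Prod.ext (Subtype.ext ?_) ?_ <;> simp [hx, hLY])
  refine ⟨_, ((Module.Free.chooseBasis ℤ (LinearMap.ker L)).prod (Pi.basisFun ℤ ι)).map e,
    fun i => ?_⟩
  simp [e, Y, Fintype.linearCombination_apply_single]

end Cone

end BipartiteToric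

/-! ### Faces of the edge cone. -/

namespace BipartiteToric

/-- Each of the finitely many inequalities holds for all sufficiently small positive `ε`. This
allows small moves from an interior point of a face without leaving the cone. -/
theorem exists_pos_forall_mul_le {E : Type} [Finite E] {f g : E → ℚ}
    (h : ∀ e, 0 < f e ∨ (0 ≤ f e ∧ g e = 0)) : ∃ ε : ℚ, 0 < ε ∧ ∀ e, ε * g e ≤ f e := by
  have hev : ∀ᶠ ε : ℚ in nhdsWithin 0 (Set.Ioi 0), ∀ e, ε * g e ≤ f e := by
    refine Filter.eventually_all.mpr fun e => ?_
    rcases h e with h | ⟨h, h'⟩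
    · have : Filter.Tendsto (fun ε : ℚ => ε * g e) (nhds 0) (nhds (0 * g e)) :=
        Filter.tendsto_id.mul_const _
      rw [zero_mul] at this
      exact nhdsWithin_le_nhds (this.eventually_le_const h)
    · simp [h, h']
  obtain ⟨ε, hε, hpos⟩ := (hev.and self_mem_nhdsWithin).exists
  exact ⟨ε, hpos, hε⟩

section Cone

variable {m n : ℕ} {E : Type} {a : E → Fin m} {b : E → Fin n}

theorem mem_edgeCone_iff {G : SimpleGraph (Fin m ⊕ Fin n)}
    (hG : ∀ i j, G.Adj (Sum.inl i) (Sum.inr j) ↔ ∃ e, a e = i ∧ b e = j) {y : NQ m n} :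
    y ∈ edgeCone G ↔ ∀ e, 0 ≤ pairing (edgeRay (a e) (b e)) y := by
  rw [edgeCone, dualEdgeCone, PointedCone.dual_hull, PointedCone.mem_dual]
  constructor
  · intro h e
    exact h ⟨a e, b e, (hG _ _).mpr ⟨e, rfl, rfl⟩, rfl⟩
  · rintro h _ ⟨i, j, hij, rfl⟩
    obtain ⟨e, rfl, rfl⟩ := (hG i j).mp hij
    exact h e

/-- A sum of one witness per edge serves as a relative interior point: the values are nonnegative,
so the sum vanishes on an edge only if each summand does. -/
theorem exists_forall_pos_of_mem [Finite E] {τ : PointedCone ℚ (NQ m n)}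
    (hτ : ∀ y ∈ τ, ∀ e, 0 ≤ pairing (edgeRay (a e) (b e)) y) :
    ∃ y ∈ τ, ∀ e, pairing (edgeRay (a e) (b e)) y = 0 →
      ∀ z ∈ τ, pairing (edgeRay (a e) (b e)) z = 0 := by
  classical
  have := Fintype.ofFinite E
  have h : ∀ e, ∃ y ∈ τ, pairing (edgeRay (a e) (b e)) y = 0 →
      ∀ z ∈ τ, pairing (edgeRay (a e) (b e)) z = 0 := by
    intro e
    by_contra! hne
    obtain ⟨-, z, hz, hz'⟩ := hne 0 τ.zero_mem
    exact hz' ((hne z hz).1)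
  choose y hy hy' using h
  refine ⟨∑ e, y e, sum_mem fun e _ => hy e, fun e he => hy' e ?_⟩
  rw [map_sum] at he
  exact (Finset.sum_eq_zero_iff_of_nonneg fun e' _ => hτ _ (hy e') e).mp he e (Finset.mem_univ e)

theorem generatedByPartOfBasis_of_isFaceOf [Finite E] {G : SimpleGraph (Fin m ⊕ Fin n)}
    (hG : ∀ i j, G.Adj (Sum.inl i) (Sum.inr j) ↔ ∃ e, a e = i ∧ b e = j)
    (hconn : IsConnected (fun e => Sum.inl (a e)) (fun e => Sum.inr (b e)))
    {τ : PointedCone ℚ (NQ m n)} (hτ : τ.IsFaceOf (edgeCone G)) (hdim : coneDim τ ≤ 2) :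
    GeneratedByPartOfBasis τ := by
  classical
  have hmem := fun y => mem_edgeCone_iff (y := y) hG
  obtain ⟨y₀, hy₀, hy₀'⟩ := exists_forall_pos_of_mem fun y hy => (hmem y).mp (hτ.le hy)
  have hy₀C := (hmem y₀).mp (hτ.le hy₀)
  let F : Set E := {e | pairing (edgeRay (a e) (b e)) y₀ = 0}
  have hFτ : ∀ y ∈ edgeCone G, (∀ e ∈ F, pairing (edgeRay (a e) (b e)) y = 0) → y ∈ τ := by
    intro y hy hyF
    obtain ⟨ε, hε, hle⟩ := exists_pos_forall_mul_le
      (f := fun e => pairing (edgeRay (a e) (b e)) y₀)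
      (g := fun e => pairing (edgeRay (a e) (b e)) y) (fun e => by
        by_cases he : e ∈ F
        · exact .inr ⟨hy₀C e, hyF e he⟩
        · exact .inl (lt_of_le_of_ne (hy₀C e) (Ne.symm he)))
    -- Writing `y₀` as `ε • y` plus another point of the cone lets the face property absorb `y`.
    refine hτ.mem_of_smul_add_mem hy (y := y₀ - ε • y) ?_ hε (by simpa using hy₀)
    rw [hmem]
    intro e
    simpa using hle e
  have hspan : ∀ φ : Fin m ⊕ Fin n → ℚ, (∀ e ∈ F, φ (Sum.inl (a e)) = φ (Sum.inr (b e))) →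
      toNQ φ ∈ Submodule.span ℚ (τ : Set (NQ m n)) := by
    intro φ hφ
    have hφF : ∀ e ∈ F, pairing (edgeRay (a e) (b e)) (toNQ φ) = 0 := fun e he => by
      rw [pairing_edgeRay_toNQ, hφ e he, sub_self]
    obtain ⟨ε, hε, hle⟩ := exists_pos_forall_mul_le
      (f := fun e => pairing (edgeRay (a e) (b e)) y₀)
      (g := fun e => pairing (edgeRay (a e) (b e)) (toNQ φ)) (fun e => by
        by_cases he : e ∈ F
        · exact .inr ⟨hy₀C e, hφF e he⟩
        · exact .inl (lt_of_le_of_ne (hy₀C e) (Ne.symm he)))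
    have h1 : y₀ - ε • toNQ φ ∈ τ := by
      refine hFτ _ ((hmem _).mpr fun e => by simpa using hle e) fun e he => ?_
      have h0 : pairing (edgeRay (a e) (b e)) y₀ = 0 := he
      simp [h0, hφF e he]
    have h2 := Submodule.sub_mem _ (Submodule.subset_span hy₀ :
      y₀ ∈ Submodule.span ℚ (τ : Set (NQ m n))) (Submodule.subset_span h1)
    rw [sub_sub_cancel] at h2
    simpa [smul_smul, hε.ne'] using Submodule.smul_mem _ ε⁻¹ h2
  obtain ⟨c, hc⟩ := toNQ_surjective y₀
  have hcF : IsFaceWeight (fun e => Sum.inl (a e)) (fun e => Sum.inr (b e)) F c := by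
    refine ⟨fun e => ?_, fun e => ?_⟩
    · simpa [← hc, pairing_edgeRay_toNQ] using hy₀C e
    · simp only [F, Set.mem_ofPred_eq, ← hc, pairing_edgeRay_toNQ, sub_eq_zero]
  let K := Contraction (fun e => Sum.inl (a e)) (fun e => Sum.inr (b e)) F
  have : Finite K := Quot.finite _
  have hcard : Nat.card K ≤ 3 := by
    have := Fintype.ofFinite K
    -- Functions on the contraction map into the span of `τ`, of dimension at most 2, and only
    -- constants are killed. Hence there are at most three contracted vertices.
    let P : (K → ℚ) →ₗ[ℚ] NQ m n := toNQ.comp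
      (LinearMap.funLeft ℚ ℚ (cls (fun e => Sum.inl (a e)) (fun e => Sum.inr (b e)) F))
    have h1 := P.finrank_range_add_finrank_ker
    rw [Module.finrank_fintype_fun_eq_card, ← Nat.card_eq_fintype_card] at h1
    have h2 : Module.finrank ℚ (LinearMap.range P) ≤ 2 := by
      refine (Submodule.finrank_mono ?_).trans hdim
      rintro _ ⟨ψ, rfl⟩
      refine hspan _ fun e he => ?_
      exact congrArg ψ (Quot.sound ⟨e, he, rfl, rfl⟩)
    have h3 : Module.finrank ℚ (LinearMap.ker P) ≤ 1 := by
      have hle : LinearMap.ker P ≤ Submodule.span ℚ {fun _ => (1 : ℚ)} := by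
        intro ψ hψ
        obtain ⟨r, hr⟩ := exists_eq_const_of_toNQ_eq_zero (LinearMap.mem_ker.mp hψ)
        refine Submodule.mem_span_singleton.mpr ⟨r, ?_⟩
        ext x
        obtain ⟨v, rfl⟩ := Quot.exists_rep x
        simpa using (congrFun hr v).symm
      exact (Submodule.finrank_mono hle).trans (finrank_span_le_card _ |>.trans (by simp))
    omega
  obtain ⟨l, s, φ, hdual⟩ := hcF.exists_isDualSystem hconn hcard
  obtain ⟨κ, B, hB⟩ := exists_basis_extending hconn s (fun i => toN (φ i))
    (fun i j => by rw [latticePairing_toN]; exact hdual.dual i j)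
  refine ⟨κ ⊕ Fin l, B, Set.range Sum.inr, ?_⟩
  rw [← Set.range_comp]
  have hgen : (fun i => latticeToNQ (B i)) ∘ Sum.inr = fun i => toNQ fun v => (φ i v : ℚ) := by
    ext1 i
    simp [hB, latticeToNQ_toN]
  rw [hgen]
  have hdualQ : ∀ i j, ((φ i (Sum.inl (a (s j))) : ℚ) - φ i (Sum.inr (b (s j)))) =
      if i = j then 1 else 0 := fun i j => by exact_mod_cast hdual.dual i j
  apply le_antisymm
  · intro y hy
    obtain ⟨ψ, rfl⟩ := toNQ_surjective y
    have hyC := (hmem _).mp (hτ.le hy)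
    simp only [pairing_edgeRay_toNQ] at hyC
    let t : Fin l → ℚ := fun i => ψ (Sum.inl (a (s i))) - ψ (Sum.inr (b (s i)))
    -- Subtracting the expansion in the `φ i` leaves a function constant along `F` and along every
    -- `s i`, hence along all edges. It is constant, so zero in `N_ℚ`; the coefficients `t i` are
    -- nonnegative because `y` lies in the cone.
    let ψ' : Fin m ⊕ Fin n → ℚ := ψ - ∑ i, t i • fun v => (φ i v : ℚ)
    have hψ'F : ∀ e ∈ F, ψ' (Sum.inl (a e)) = ψ' (Sum.inr (b e)) := fun e he => by
      have h1 := hy₀' e he _ hy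
      rw [pairing_edgeRay_toNQ, sub_eq_zero] at h1
      have h2 : ∀ i, φ i (Sum.inl (a e)) = φ i (Sum.inr (b e)) := fun i => hdual.eq_of_mem i e he
      simp [ψ', h1, h2]
    have hψ's : ∀ j, ψ' (Sum.inl (a (s j))) - ψ' (Sum.inr (b (s j))) = 0 := fun j => by
      simp only [ψ', Pi.sub_apply, Finset.sum_apply, Pi.smul_apply, smul_eq_mul]
      rw [sub_sub_sub_comm, ← Finset.sum_sub_distrib]
      simp [← mul_sub, hdualQ, t]
    have hconst := hconn _ ψ' fun e => by
      obtain ⟨c, hc⟩ := hdual.exists_sub_eq e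
      have := hc ψ' hψ'F
      simp only [hψ's, smul_zero, Finset.sum_const_zero] at this
      exact sub_eq_zero.mp this
    have h0 : toNQ ψ' = 0 := by
      rcases isEmpty_or_nonempty (Fin m ⊕ Fin n) with h | ⟨⟨v⟩⟩
      · rw [Subsingleton.elim ψ' 0, map_zero]
      · rw [show ψ' = fun _ => ψ' v from funext fun u => hconst u v, toNQ_const]
    rw [map_sub, map_sum, sub_eq_zero] at h0
    rw [h0]
    refine sum_mem fun i _ => ?_
    rw [map_smul]
    exact PointedCone.smul_mem _ (sub_nonneg.mpr (sub_nonneg.mp (hyC (s i))))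
      (Submodule.subset_span ⟨i, rfl⟩)
  · refine Submodule.span_le.mpr ?_
    rintro _ ⟨i, rfl⟩
    refine hFτ _ ((hmem _).mpr fun e => ?_) fun e he => ?_
    · rw [pairing_edgeRay_toNQ]
      obtain ⟨c, hc⟩ := hdual.exists_sub_eq e
      have := hc (fun v => (φ i v : ℚ)) fun f hf => by exact_mod_cast hdual.eq_of_mem i f hf
      rw [this]
      refine Finset.sum_nonneg fun j _ => nsmul_nonneg ?_ _
      rw [hdualQ]
      split_ifs <;> norm_num
    · rw [pairing_edgeRay_toNQ, sub_eq_zero]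
      exact_mod_cast hdual.eq_of_mem i e he

end Cone

end BipartiteToric

noncomputable section

namespace BipartiteToric

/-! ### Monomials and signed incidence vectors. -/

section Monomial

variable {V ι : Type}

/-- The exponent of the image of a monomial under `x_k ↦ t_{u k} t_{w k}`. -/
def vertexExp (u w : ι → V) : (ι →₀ ℕ) →ₗ[ℕ] (V →₀ ℕ) :=
  Finsupp.linearCombination ℕ fun k => Finsupp.single (u k) 1 + Finsupp.single (w k) 1

theorem aeval_monomial_eq_vertexExp (u w : ι → V) (β : ι →₀ ℕ) (r : ℂ) :
    MvPolynomial.aeval (fun k => MvPolynomial.X (R := ℂ) (u k) * MvPolynomial.X (w k))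
      (MvPolynomial.monomial β r) = MvPolynomial.monomial (vertexExp u w β) r := by
  induction β using Finsupp.induction_linear generalizing r with
  | zero => simp [MvPolynomial.algebraMap_eq]
  | add β γ hβ hγ =>
    rw [← mul_one r, ← MvPolynomial.monomial_mul, map_mul, hβ, hγ, MvPolynomial.monomial_mul,
      map_add]
  | single k c =>
    rw [MvPolynomial.aeval_monomial, Finsupp.prod_single_index (by simp), vertexExp,
      Finsupp.linearCombination_single, MvPolynomial.algebraMap_eq, MvPolynomial.X,
      MvPolynomial.X, MvPolynomial.monomial_mul, MvPolynomial.monomial_pow,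
      MvPolynomial.C_mul_monomial]
    simp

variable [DecidableEq V] {u w : ι → V} {ε : V → ℤˣ}

/-- This is where bipartiteness enters: all edges meet a given vertex with the same sign, so
exponents of monomials and signed incidence sums carry the same information. -/
theorem linearCombination_edgeVec_apply (hu : ∀ k, ε (u k) = 1) (hw : ∀ k, ε (w k) = -1)
    (β : ι →₀ ℕ) (v : V) :
    Finsupp.linearCombination ℕ (edgeVec u w) β v = ε v * (vertexExp u w β v : ℤ) := by
  induction β using Finsupp.induction_linear with
  | zero => simp
  | add β γ hβ hγ => simp [hβ, hγ, mul_add]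
  | single k c =>
    have h1 : (Finsupp.single (u k) 1 v : ℤ) = ε v * (Finsupp.single (u k) (1 : ℕ) v : ℤ) := by
      rcases eq_or_ne (u k) v with rfl | h
      · simp [hu]
      · simp [Finsupp.single_eq_of_ne' h]
    have h2 : -(Finsupp.single (w k) 1 v : ℤ) = ε v * (Finsupp.single (w k) (1 : ℕ) v : ℤ) := by
      rcases eq_or_ne (w k) v with rfl | h
      · simp [hw]
      · simp [Finsupp.single_eq_of_ne' h]
    simp only [vertexExp, Finsupp.linearCombination_single, edgeVec, Pi.smul_apply, Pi.add_apply, Pi.neg_apply,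
      Finsupp.smul_apply, Finsupp.add_apply, nsmul_eq_mul, smul_eq_mul, Nat.cast_mul,
      Nat.cast_add, ← Finsupp.single_eq_pi_single, sub_eq_add_neg]
    rw [h2, h1]
    ring

theorem vertexExp_eq_iff (hu : ∀ k, ε (u k) = 1) (hw : ∀ k, ε (w k) = -1) {β γ : ι →₀ ℕ} :
    vertexExp u w β = vertexExp u w γ ↔
      Finsupp.linearCombination ℕ (edgeVec u w) β =
        Finsupp.linearCombination ℕ (edgeVec u w) γ := by
  rw [DFunLike.ext_iff, funext_iff]
  refine forall_congr' fun v => ?_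
  rw [linearCombination_edgeVec_apply hu hw, linearCombination_edgeVec_apply hu hw,
    mul_right_inj' (ε v).ne_zero, Nat.cast_inj]

theorem vertexExp_injective (hu : ∀ k, ε (u k) = 1) (hw : ∀ k, ε (w k) = -1)
    (h : LinearIndependent ℤ (edgeVec u w)) : Function.Injective (vertexExp u w) := by
  intro β γ hβγ
  rw [vertexExp_eq_iff hu hw] at hβγ
  exact h.restrict_scalars' ℕ hβγ

theorem injective_of_monomial {σ : Type} (f : MvPolynomial σ ℂ →ₐ[ℂ] MvPolynomial V ℂ)
    (θ : (σ →₀ ℕ) → (V →₀ ℕ)) (hθ : Function.Injective θ)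
    (hf : ∀ β r, f (MvPolynomial.monomial β r) = MvPolynomial.monomial (θ β) r) :
    Function.Injective f := by
  classical
  rw [injective_iff_map_eq_zero]
  intro p hp
  ext β
  have h := congrArg (MvPolynomial.coeff (θ β)) hp
  rw [p.as_sum, map_sum, MvPolynomial.coeff_sum] at h
  simp only [hf, MvPolynomial.coeff_monomial, hθ.eq_iff] at h
  simpa using h

end Monomial

/-! ### The coordinate ring and its face ideals. -/

section Ring

variable {V : Type} {G : SimpleGraph V} {src tgt : G.edgeSet → V} {ε : V → ℤˣ}

variable (G) in
/-- The coordinate function of an edge. -/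
def coord (e : G.edgeSet) : CoordRing G :=
  Ideal.Quotient.mk _ (MvPolynomial.X e)

variable (G) in
/-- A monomial in the coordinate functions. -/
def coordMonomial (β : G.edgeSet →₀ ℕ) : CoordRing G :=
  Ideal.Quotient.mk _ (MvPolynomial.monomial β 1)

theorem coordMonomial_add (β γ : G.edgeSet →₀ ℕ) :
    coordMonomial G (β + γ) = coordMonomial G β * coordMonomial G γ := by
  rw [coordMonomial, ← one_mul (1 : ℂ), ← MvPolynomial.monomial_mul, map_mul]
  rfl

theorem coordMonomial_zero : coordMonomial G 0 = 1 := map_one _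

theorem coordMonomial_single (e : G.edgeSet) (k : ℕ) :
    coordMonomial G (Finsupp.single e k) = coord G e ^ k := by
  rw [coordMonomial, coord, ← map_pow, MvPolynomial.X_pow_eq_monomial]

theorem coordMonomial_sum {ι : Type} (s : Finset ι) (t : ι → G.edgeSet) (k : ι → ℕ) :
    coordMonomial G (∑ i ∈ s, Finsupp.single (t i) (k i)) = ∏ i ∈ s, coord G (t i) ^ k i := by
  classical
  induction s using Finset.induction_on with
  | empty => simp [coordMonomial_zero]
  | insert i s hi ih =>
    rw [Finset.sum_insert hi, Finset.prod_insert hi, coordMonomial_add, coordMonomial_single, ih]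

theorem coordMonomial_notMem {P : Ideal (CoordRing G)} [P.IsPrime] {β : G.edgeSet →₀ ℕ}
    (h : ∀ e ∈ β.support, coord G e ∉ P) : coordMonomial G β ∉ P := by
  rw [← Finsupp.sum_single β, Finsupp.sum, coordMonomial_sum]
  intro hmem
  obtain ⟨e, he, hmem⟩ := Ideal.IsPrime.prod_mem_iff.mp hmem
  exact h e he (Ideal.IsPrime.mem_of_pow_mem inferInstance _ hmem)

variable (G) in
/-- The embedding of the coordinate ring as the edge ring. -/
def coordEmbedding : CoordRing G →ₐ[ℂ] MvPolynomial V ℂ :=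
  Ideal.Quotient.liftₐ (edgeIdeal G) (edgeHom G) fun _ h => h

theorem coordEmbedding_injective : Function.Injective (coordEmbedding G) :=
  RingHom.lift_injective_of_ker_le_ideal _ (fun _ h => h) le_rfl

instance : IsDomain (CoordRing G) :=
  coordEmbedding_injective.isDomain (coordEmbedding G).toRingHom

theorem edgeHom_eq (hst : ∀ e : G.edgeSet, e.1 = s(src e, tgt e)) :
    edgeHom G = MvPolynomial.aeval fun e =>
      MvPolynomial.X (R := ℂ) (src e) * MvPolynomial.X (tgt e) := by
  refine MvPolynomial.algHom_ext fun e => ?_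
  rw [edgeHom, MvPolynomial.aeval_X, MvPolynomial.aeval_X, hst e, Sym2.map_mk, Sym2.mul_mk]

theorem coordEmbedding_coord (hst : ∀ e : G.edgeSet, e.1 = s(src e, tgt e)) (e : G.edgeSet) :
    coordEmbedding G (coord G e) = MvPolynomial.X (src e) * MvPolynomial.X (tgt e) := by
  change edgeHom G (MvPolynomial.X e) = _
  rw [edgeHom_eq hst, MvPolynomial.aeval_X]

theorem coordMonomial_eq [DecidableEq V] (hst : ∀ e : G.edgeSet, e.1 = s(src e, tgt e))
    (hs : ∀ e, ε (src e) = 1) (ht : ∀ e, ε (tgt e) = -1) {β γ : G.edgeSet →₀ ℕ}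
    (h : Finsupp.linearCombination ℕ (edgeVec src tgt) β =
      Finsupp.linearCombination ℕ (edgeVec src tgt) γ) :
    coordMonomial G β = coordMonomial G γ := by
  apply coordEmbedding_injective
  change edgeHom G _ = edgeHom G _
  rw [edgeHom_eq hst, aeval_monomial_eq_vertexExp, aeval_monomial_eq_vertexExp,
    (vertexExp_eq_iff hs ht).mpr h]

theorem aeval_coord_injective [DecidableEq V] (hst : ∀ e : G.edgeSet, e.1 = s(src e, tgt e))
    (hs : ∀ e, ε (src e) = 1) (ht : ∀ e, ε (tgt e) = -1) {ι : Type} {t : ι → G.edgeSet}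
    (h : LinearIndependent ℤ fun k => edgeVec src tgt (t k)) :
    Function.Injective (MvPolynomial.aeval (R := ℂ) fun k => coord G (t k)) := by
  refine Function.Injective.of_comp (f := coordEmbedding G) ?_
  rw [← AlgHom.coe_comp, MvPolynomial.comp_aeval]
  simp only [coordEmbedding_coord hst]
  exact injective_of_monomial _ _ (vertexExp_injective (fun k => hs (t k)) (fun k => ht (t k)) h)
    (aeval_monomial_eq_vertexExp (fun k => src (t k)) (fun k => tgt (t k)))

/-- The ideal generated by the coordinates of the edges outside of `F`. -/
def faceIdeal (F : Set G.edgeSet) : Ideal (CoordRing G) :=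
  Ideal.span (coord G '' Fᶜ)

open Classical in
/-- The morphism that kills the coordinates of the edges outside of `F`. -/
def faceHom (src tgt : G.edgeSet → V) (F : Set G.edgeSet) :
    MvPolynomial G.edgeSet ℂ →ₐ[ℂ] MvPolynomial V ℂ :=
  MvPolynomial.aeval fun e =>
    if e ∈ F then MvPolynomial.X (src e) * MvPolynomial.X (tgt e) else 0

/-- The face weight gives a one-parameter degeneration: scaling `x_e` by the power of a parameter
`X` given by the drop of `c` along `e` preserves the relations of `I_G`. At `X = 0` exactly the
coordinates of `F` survive. -/
theorem edgeIdeal_le_ker_faceHom (hst : ∀ e : G.edgeSet, e.1 = s(src e, tgt e))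
    (hs : ∀ e, ε (src e) = 1) (ht : ∀ e, ε (tgt e) = -1) {F : Set G.edgeSet} {c : V → ℤ}
    (hc : IsFaceWeight src tgt F c) :
    edgeIdeal G ≤ RingHom.ker (faceHom src tgt F) := by
  let H : MvPolynomial G.edgeSet ℂ →ₐ[ℂ] Polynomial (MvPolynomial V ℂ) :=
    MvPolynomial.aeval fun e =>
      Polynomial.C (MvPolynomial.X (src e) * MvPolynomial.X (tgt e)) *
        Polynomial.X ^ (c (src e) - c (tgt e)).toNat
  -- The scaling comes from rescaling the vertex variables. Individual exponents `ε v * c v` may be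
  -- negative, hence the Laurent polynomials.
  let L : MvPolynomial V ℂ →ₐ[ℂ] LaurentPolynomial (MvPolynomial V ℂ) :=
    MvPolynomial.aeval fun v =>
      LaurentPolynomial.C (MvPolynomial.X v) * LaurentPolynomial.T (ε v * c v)
  have hHL : ∀ f, Polynomial.toLaurent (H f) = L (edgeHom G f) := by
    intro f
    induction f using MvPolynomial.induction_on with
    | C r =>
      rw [← MvPolynomial.algebraMap_eq, AlgHom.commutes, AlgHom.commutes, AlgHom.commutes,
        Polynomial.algebraMap_apply, Polynomial.toLaurent_C]
      rfl
    | add p q hp hq => simp only [map_add, hp, hq]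
    | mul_X p e hp =>
      rw [map_mul, map_mul, hp, map_mul, map_mul, edgeHom_eq hst]
      congr 1
      simp only [H, L, MvPolynomial.aeval_X, map_mul, map_pow, Polynomial.toLaurent_C,
        Polynomial.toLaurent_X, hs, ht, LaurentPolynomial.T_pow]
      rw [mul_mul_mul_comm, ← LaurentPolynomial.T_add,
        Int.toNat_of_nonneg (sub_nonneg.mpr (hc.le e))]
      simp [sub_eq_add_neg]
  have hface : ∀ f, faceHom src tgt F f = Polynomial.eval 0 (H f) := by
    intro f
    induction f using MvPolynomial.induction_on with
    | C r =>
      rw [← MvPolynomial.algebraMap_eq, AlgHom.commutes, AlgHom.commutes,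
        Polynomial.algebraMap_apply, Polynomial.eval_C]
    | add p q hp hq => simp only [map_add, hp, hq, Polynomial.eval_add]
    | mul_X p e hp =>
      rw [map_mul, map_mul, hp, Polynomial.eval_mul]
      congr 1
      by_cases he : e ∈ F
      · have := (hc.mem_iff e).mp he
        simp [faceHom, H, he, this]
      · have := lt_of_le_of_ne (hc.le e) fun h => he ((hc.mem_iff e).mpr h.symm)
        simp [faceHom, H, he, this]
  intro f hf
  have h0 : H f = 0 := by
    apply Polynomial.toLaurent_injective
    rw [hHL, show edgeHom G f = 0 from hf, map_zero, map_zero]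
  rw [RingHom.mem_ker, hface, h0, Polynomial.eval_zero]

theorem mk_mem_faceIdeal_iff (hst : ∀ e : G.edgeSet, e.1 = s(src e, tgt e))
    (hs : ∀ e, ε (src e) = 1) (ht : ∀ e, ε (tgt e) = -1) {F : Set G.edgeSet} {c : V → ℤ}
    (hc : IsFaceWeight src tgt F c) (f : MvPolynomial G.edgeSet ℂ) :
    (Ideal.Quotient.mk (edgeIdeal G) f ∈ faceIdeal F) ↔ faceHom src tgt F f = 0 := by
  classical
  constructor
  · intro h
    let L : CoordRing G →ₐ[ℂ] MvPolynomial V ℂ :=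
      Ideal.Quotient.liftₐ (edgeIdeal G) (faceHom src tgt F)
        fun _ h => edgeIdeal_le_ker_faceHom hst hs ht hc h
    have hle : faceIdeal F ≤ RingHom.ker L := by
      rw [faceIdeal, Ideal.span_le]
      rintro _ ⟨e, he, rfl⟩
      change faceHom src tgt F (MvPolynomial.X e) = 0
      rw [faceHom, MvPolynomial.aeval_X, if_neg he]
    exact hle h
  · intro h
    -- Dropping the variables outside `F` does not change `f` modulo the face ideal, and on what
    -- remains the edge map computes `faceHom`.
    let R₀ : MvPolynomial G.edgeSet ℂ →ₐ[ℂ] MvPolynomial G.edgeSet ℂ :=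
      MvPolynomial.aeval fun e => if e ∈ F then MvPolynomial.X e else 0
    have h1 : edgeHom G (R₀ f) = 0 := by
      rw [← h, ← AlgHom.comp_apply]
      congr 1
      refine MvPolynomial.algHom_ext fun e => ?_
      by_cases he : e ∈ F <;> simp [R₀, faceHom, edgeHom_eq hst, he]
    have h2 : (Ideal.Quotient.mkₐ ℂ (faceIdeal F)).comp (Ideal.Quotient.mkₐ ℂ (edgeIdeal G)) =
        ((Ideal.Quotient.mkₐ ℂ (faceIdeal F)).comp (Ideal.Quotient.mkₐ ℂ (edgeIdeal G))).comp
          R₀ := by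
      refine MvPolynomial.algHom_ext fun e => ?_
      by_cases he : e ∈ F
      · simp [R₀, he]
      · have : coord G e ∈ faceIdeal F := Ideal.subset_span ⟨e, he, rfl⟩
        rw [coord, ← Ideal.Quotient.eq_zero_iff_mem] at this
        simpa [R₀, he] using this
    have h3 := AlgHom.congr_fun h2 f
    have h4 : Ideal.Quotient.mk (edgeIdeal G) (R₀ f) = 0 := Ideal.Quotient.eq_zero_iff_mem.mpr h1
    rw [← Ideal.Quotient.eq_zero_iff_mem]
    simpa [h4] using h3

theorem isPrime_faceIdeal (hst : ∀ e : G.edgeSet, e.1 = s(src e, tgt e))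
    (hs : ∀ e, ε (src e) = 1) (ht : ∀ e, ε (tgt e) = -1) {F : Set G.edgeSet} {c : V → ℤ}
    (hc : IsFaceWeight src tgt F c) : (faceIdeal F).IsPrime := by
  have h : faceIdeal F = (RingHom.ker (faceHom src tgt F)).map (Ideal.Quotient.mk (edgeIdeal G)) := by
    ext x
    obtain ⟨f, rfl⟩ := Ideal.Quotient.mk_surjective x
    rw [mk_mem_faceIdeal_iff hst hs ht hc, ← RingHom.mem_ker,
      Ideal.mem_quotient_iff_mem (edgeIdeal_le_ker_faceHom hst hs ht hc)]
  rw [h]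
  have := RingHom.ker_isPrime (faceHom src tgt F)
  exact Ideal.map_isPrime_of_surjective Ideal.Quotient.mk_surjective
    (by rw [Ideal.mk_ker]; exact edgeIdeal_le_ker_faceHom hst hs ht hc)

theorem coord_mem_faceIdeal_iff (hst : ∀ e : G.edgeSet, e.1 = s(src e, tgt e))
    (hs : ∀ e, ε (src e) = 1) (ht : ∀ e, ε (tgt e) = -1) {F : Set G.edgeSet} {c : V → ℤ}
    (hc : IsFaceWeight src tgt F c) (e : G.edgeSet) :
    coord G e ∈ faceIdeal F ↔ e ∉ F := by
  rw [coord, mk_mem_faceIdeal_iff hst hs ht hc]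
  by_cases he : e ∈ F <;> simp [faceHom, he]

/-- The height of a face ideal is at least its expected value. -/
theorem card_contraction_le_height [Finite V] (hst : ∀ e : G.edgeSet, e.1 = s(src e, tgt e))
    (hs : ∀ e, ε (src e) = 1) (ht : ∀ e, ε (tgt e) = -1) (hconn : IsConnected src tgt)
    (F : Set G.edgeSet) (c : V → ℤ) (hc : IsFaceWeight src tgt F c) :
    (Nat.card (Contraction src tgt F) : ℕ∞) ≤ (faceIdeal F).height + 1 := by
  have : Finite G.edgeSet := Subtype.finite
  -- Enlarging the face merges at most one more vertex and strictly shrinks its prime ideal, so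
  -- iterating down to one vertex produces a long enough chain of primes.
  induction F using WellFoundedGT.induction generalizing c with
  | ind F ih =>
    by_cases hcard : 2 ≤ Nat.card (Contraction src tgt F)
    · obtain ⟨F', c', hc', hlt, hle⟩ := hc.exists_larger hconn hcard
      have := isPrime_faceIdeal hst hs ht hc
      have := isPrime_faceIdeal hst hs ht hc'
      have hlt' : faceIdeal F' < faceIdeal F := by
        refine lt_of_le_of_ne (Ideal.span_mono (Set.image_mono
          (Set.compl_subset_compl.mpr hlt.subset))) fun h => ?_
        obtain ⟨e, he, he'⟩ := Set.exists_of_ssubset hlt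
        have := (coord_mem_faceIdeal_iff hst hs ht hc e).mpr he'
        rw [← h, coord_mem_faceIdeal_iff hst hs ht hc'] at this
        exact this he
      calc (Nat.card (Contraction src tgt F) : ℕ∞)
          ≤ Nat.card (Contraction src tgt F') + 1 := by exact_mod_cast hle
        _ ≤ (faceIdeal F').height + 1 + 1 := by gcongr; exact ih F' hlt c' hc'
        _ ≤ (faceIdeal F).height + 1 := by
          gcongr
          exact Ideal.height_add_one_le_of_lt_of_isPrime hlt'
    · have : (Nat.card (Contraction src tgt F) : ℕ∞) ≤ 1 := by
        exact_mod_cast (by omega : Nat.card (Contraction src tgt F) ≤ 1)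
      exact this.trans le_add_self

end Ring

end BipartiteToric

end

noncomputable section

namespace BipartiteToric

/-! ### Smoothness at primes of small height. -/

section Smooth

/-- A localization of an algebra is smooth if it is a localization of a polynomial subring. -/
theorem formallySmooth_localization_of_injective {ι R : Type} [CommRing R] [IsDomain R]
    [Algebra ℂ R] (Φ : MvPolynomial ι ℂ →ₐ[ℂ] R) (hΦ : Function.Injective Φ)
    {p₀ : MvPolynomial ι ℂ} (hp₀ : p₀ ≠ 0)
    (hsurj : ∀ r, ∃ (k : ℕ) (p : MvPolynomial ι ℂ), r * Φ p₀ ^ k = Φ p) :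
    Algebra.FormallySmooth ℂ (Localization.Away (Φ p₀)) := by
  let S := Localization.Away (Φ p₀)
  let : Algebra (MvPolynomial ι ℂ) S := ((algebraMap R S).comp Φ.toRingHom).toAlgebra
  have halg : ∀ p, algebraMap (MvPolynomial ι ℂ) S p = algebraMap R S (Φ p) := fun _ => rfl
  have : IsScalarTower ℂ (MvPolynomial ι ℂ) S := IsScalarTower.of_algebraMap_eq fun r => by
    rw [halg, AlgHom.commutes, ← IsScalarTower.algebraMap_apply]
  have hne : Φ p₀ ≠ 0 := fun h => hp₀ (hΦ (by rw [h, map_zero]))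
  have hinj : Function.Injective (algebraMap R S) :=
    IsLocalization.injective S (powers_le_nonZeroDivisors_of_noZeroDivisors hne)
  have : IsLocalization.Away p₀ S := by
    refine ⟨?_, ?_, ?_⟩
    · rintro ⟨_, k, rfl⟩
      rw [halg]
      simp only [map_pow]
      exact (IsLocalization.Away.algebraMap_isUnit (Φ p₀)).pow k
    · intro z
      obtain ⟨⟨r, ⟨_, j, rfl⟩⟩, hz⟩ := IsLocalization.surj (Submonoid.powers (Φ p₀)) z
      obtain ⟨k, p, hp⟩ := hsurj r
      refine ⟨⟨p, ⟨p₀ ^ (j + k), j + k, rfl⟩⟩, ?_⟩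
      rw [halg, halg, ← hp, map_mul, ← hz]
      simp only [map_pow, map_mul, pow_add]
      ring
    · intro x y hxy
      exact ⟨1, by rw [hΦ (hinj hxy)]⟩
  have : Algebra.FormallySmooth (MvPolynomial ι ℂ) S :=
    Algebra.FormallySmooth.of_isLocalization (Submonoid.powers p₀)
  exact Algebra.FormallySmooth.comp ℂ (MvPolynomial ι ℂ) S

theorem mem_smoothLocus_of_localization {R : Type} [CommRing R] [Algebra ℂ R]
    [Algebra.FinitePresentation ℂ R]
    [LocallyOfFinitePresentation (Spec.map (CommRingCat.ofHom (algebraMap ℂ R)))]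
    (x : Spec (CommRingCat.of R)) (g : R) (hg : g ∉ x.asIdeal)
    [Algebra.FormallySmooth ℂ (Localization.Away g)] :
    x ∈ (Spec.map (CommRingCat.ofHom (algebraMap ℂ R))).smoothLocus := by
  have : Algebra.FinitePresentation R (Localization.Away g) :=
    IsLocalization.Away.finitePresentation g
  have : Algebra.FinitePresentation ℂ (Localization.Away g) :=
    Algebra.FinitePresentation.trans ℂ R _
  have : Algebra.Smooth ℂ (Localization.Away g) := ⟨inferInstance, inferInstance⟩
  let j : Spec (CommRingCat.of (Localization.Away g)) ⟶ Spec (CommRingCat.of R) :=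
    Spec.map (CommRingCat.ofHom (algebraMap R (Localization.Away g)))
  have hj : IsOpenImmersion j := inferInstance
  have hx : x ∈ Set.range j := by
    have := PrimeSpectrum.localization_away_comap_range (Localization.Away g) g
    exact this.symm.subset hg
  obtain ⟨y, rfl⟩ := hx
  have hcomp : j ≫ Spec.map (CommRingCat.ofHom (algebraMap ℂ R)) =
      Spec.map (CommRingCat.ofHom (algebraMap ℂ (Localization.Away g))) := by
    rw [← Spec.map_comp, ← CommRingCat.ofHom_comp, ← IsScalarTower.algebraMap_eq]
  have hsm : Smooth (j ≫ Spec.map (CommRingCat.ofHom (algebraMap ℂ R))) := by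
    rw [hcomp, HasRingHomProperty.Spec_iff (P := @Smooth)]
    exact (RingHom.smooth_algebraMap).mpr inferInstance
  have h := Scheme.Hom.preimage_smoothLocus_eq j (Spec.map (CommRingCat.ofHom (algebraMap ℂ R)))
  rw [Scheme.Hom.smoothLocus_eq_top (j ≫ _)] at h
  exact h.symm.le (Set.mem_univ y)

end Smooth

section Ring

variable {V : Type} [DecidableEq V] {G : SimpleGraph V} {src tgt : G.edgeSet → V}
  {ε : V → ℤˣ}

/-- A monomial in coordinates outside `P` stays outside `P`, so it has no factor in `P`. The edges
outside `P` are therefore closed under summands. -/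
theorem exists_isFaceWeight_of_isPrime [Finite V] (hst : ∀ e : G.edgeSet, e.1 = s(src e, tgt e))
    (hs : ∀ e, ε (src e) = 1) (ht : ∀ e, ε (tgt e) = -1) (P : Ideal (CoordRing G)) [P.IsPrime] :
    ∃ c : V → ℤ, IsFaceWeight src tgt {e | coord G e ∉ P} c := by
  refine exists_isFaceWeight fun e β γ hγ h he => ?_
  refine coordMonomial_notMem hγ ?_
  rw [← coordMonomial_eq hst hs ht (β := Finsupp.single e 1 + β) (by simpa using h),
    coordMonomial_add, coordMonomial_single, pow_one]
  exact P.mul_mem_right _ he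

theorem card_contraction_le_of_height_le [Finite V] (hst : ∀ e : G.edgeSet, e.1 = s(src e, tgt e))
    (hs : ∀ e, ε (src e) = 1) (ht : ∀ e, ε (tgt e) = -1) (hconn : IsConnected src tgt)
    (P : Ideal (CoordRing G)) [P.IsPrime] {k : ℕ} (hP : P.height ≤ k) :
    Nat.card (Contraction src tgt {e | coord G e ∉ P}) ≤ k + 1 := by
  obtain ⟨c, hc⟩ := exists_isFaceWeight_of_isPrime hst hs ht P
  have h := card_contraction_le_height hst hs ht hconn _ c hc
  have hle : faceIdeal {e | coord G e ∉ P} ≤ P := by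
    rw [faceIdeal, Ideal.span_le]
    rintro _ ⟨e, he, rfl⟩
    exact not_not.mp he
  have h' := h.trans (add_le_add_left ((Ideal.height_mono hle).trans hP) 1)
  exact_mod_cast h'

/-- Multiplying with a power of the given edges of `F` turns every edge into a monomial. -/
theorem exists_coord_mul_pow_eq (hst : ∀ e : G.edgeSet, e.1 = s(src e, tgt e))
    (hs : ∀ e, ε (src e) = 1) (ht : ∀ e, ε (tgt e) = -1) {F : Set G.edgeSet}
    {ι κ : Type} [Fintype ι] [DecidableEq ι] [Fintype κ] {s : ι → G.edgeSet} {φ : ι → V → ℤ}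
    (hdual : IsDualSystem src tgt F s φ) {t : κ → G.edgeSet}
    (hspan : edgeSpan src tgt F = Submodule.span ℤ (Set.range fun k => edgeVec src tgt (t k)))
    (e : G.edgeSet) :
    ∃ (N : ℕ) (α : κ → ℕ) (β : ι → ℕ), coord G e * (∏ k, coord G (t k)) ^ N =
      (∏ k, coord G (t k) ^ α k) * ∏ i, coord G (s i) ^ β i := by
  obtain ⟨β, hβ⟩ := hdual.gen e
  rw [hspan, Submodule.mem_span_range_iff_exists_fun] at hβ
  obtain ⟨z, hz⟩ := hβ
  -- A single exponent large enough to clear every negative coefficient `z k`.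
  let N := ∑ k, (z k).natAbs
  have hN : ∀ k, 0 ≤ N + z k := fun k => by
    have := Finset.single_le_sum (f := fun k => (z k).natAbs) (fun _ _ => Nat.zero_le _)
      (Finset.mem_univ k)
    change (z k).natAbs ≤ N at this
    omega
  refine ⟨N, fun k => (N + z k).toNat, β, ?_⟩
  rw [← Finset.prod_pow, ← coordMonomial_sum, ← coordMonomial_sum, ← coordMonomial_sum,
    ← pow_one (coord G e), ← coordMonomial_single, ← coordMonomial_add, ← coordMonomial_add]
  refine coordMonomial_eq hst hs ht ?_
  simp only [map_add, map_sum, Finsupp.linearCombination_single, one_smul]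
  have h1 : ∀ k, (N + z k).toNat • edgeVec src tgt (t k) =
      N • edgeVec src tgt (t k) + z k • edgeVec src tgt (t k) := fun k => by
    rw [← natCast_zsmul, Int.toNat_of_nonneg (hN k), add_smul, natCast_zsmul]
  simp only [h1, Finset.sum_add_distrib, hz]
  abel

/-- The basis edges of the face together with the dual system are independent, so their coordinates
generate a polynomial subring. Inverting the product of the basis coordinates, which lies outside
`P`, makes this subring reach every other coordinate. -/
theorem exists_formallySmooth_localization [Finite V] (hst : ∀ e : G.edgeSet, e.1 = s(src e, tgt e))
    (hs : ∀ e, ε (src e) = 1) (ht : ∀ e, ε (tgt e) = -1) (hconn : IsConnected src tgt)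
    (P : Ideal (CoordRing G)) [P.IsPrime] (hP : P.height ≤ 2) :
    ∃ g ∉ P, Algebra.FormallySmooth ℂ (Localization.Away g) := by
  classical
  have := Fintype.ofFinite V
  have : Finite G.edgeSet := Subtype.finite
  obtain ⟨c, hc⟩ := exists_isFaceWeight_of_isPrime hst hs ht P
  obtain ⟨l, s, φ, hdual⟩ := hc.exists_isDualSystem hconn
    (card_contraction_le_of_height_le hst hs ht hconn P hP)
  obtain ⟨κ, _, t, htF, hli, hspan⟩ := exists_linearIndependent_edgeSpan (src := src) (tgt := tgt)
    (Set.toFinite {e | coord G e ∉ P})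
  have hli' : LinearIndependent ℤ fun x => edgeVec src tgt (Sum.elim t s x) := by
    have := linearIndependent_sumElim_of_dual hli (fun i => edgeVec src tgt (s i))
      (fun i => dotProductBilin ℤ ℤ (φ i))
      (fun i k => by simp [dotProduct_edgeVec, hdual.eq_of_mem i _ (htF k)])
      (fun i j => by simpa [dotProduct_edgeVec] using hdual.dual i j)
    rwa [show (fun x => edgeVec src tgt (Sum.elim t s x)) = Sum.elim
      (fun k => edgeVec src tgt (t k)) (fun i => edgeVec src tgt (s i)) by ext (k | i) <;> rfl]
  let Φ : MvPolynomial (κ ⊕ Fin l) ℂ →ₐ[ℂ] CoordRing G :=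
    MvPolynomial.aeval fun x => coord G (Sum.elim t s x)
  have hΦ : Function.Injective Φ := aeval_coord_injective hst hs ht hli'
  let p₀ : MvPolynomial (κ ⊕ Fin l) ℂ := ∏ k, MvPolynomial.X (Sum.inl k)
  have hΦp₀ : Φ p₀ = ∏ k, coord G (t k) := by simp [Φ, p₀]
  have hp₀ : Φ p₀ ∉ P := by
    rw [hΦp₀]
    intro h
    obtain ⟨k, -, hk⟩ := Ideal.IsPrime.prod_mem_iff.mp h
    exact htF k hk
  refine ⟨Φ p₀, hp₀, formallySmooth_localization_of_injective Φ hΦ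
    (fun h => hp₀ (by rw [h, map_zero]; exact P.zero_mem)) fun r => ?_⟩
  obtain ⟨f, rfl⟩ := Ideal.Quotient.mk_surjective r
  induction f using MvPolynomial.induction_on with
  | C r => exact ⟨0, MvPolynomial.C r, by
      rw [pow_zero, mul_one, ← MvPolynomial.algebraMap_eq, ← MvPolynomial.algebraMap_eq,
        AlgHom.commutes]
      rfl⟩
  | add p q hp hq =>
    obtain ⟨k, p', hp⟩ := hp
    obtain ⟨j, q', hq⟩ := hq
    refine ⟨k + j, p' * p₀ ^ j + q' * p₀ ^ k, ?_⟩
    rw [map_add, map_add, map_mul, map_mul, ← hp, ← hq, map_pow, map_pow]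
    ring
  | mul_X p e hp =>
    obtain ⟨k, p', hp⟩ := hp
    obtain ⟨N, α, β, h⟩ := exists_coord_mul_pow_eq hst hs ht hdual hspan e
    refine ⟨k + N, p' * ((∏ k, MvPolynomial.X (Sum.inl k) ^ α k) *
      ∏ i, MvPolynomial.X (Sum.inr i) ^ β i), ?_⟩
    have h' : Φ ((∏ k, MvPolynomial.X (Sum.inl k) ^ α k) *
      ∏ i, MvPolynomial.X (Sum.inr i) ^ β i) = coord G e * Φ p₀ ^ N := by
      rw [hΦp₀, h]
      simp [Φ]
    rw [map_mul, map_mul, ← hp, h', pow_add]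
    change _ * coord G e * _ = _
    ring

theorem smoothInCodim_two [Finite V] (hst : ∀ e : G.edgeSet, e.1 = s(src e, tgt e))
    (hs : ∀ e, ε (src e) = 1) (ht : ∀ e, ε (tgt e) = -1) (hconn : IsConnected src tgt) :
    SmoothInCodim (TV.structureMap G) 2 := by
  intro x hx
  have : Finite G.edgeSet := Subtype.finite
  have : x.asIdeal.IsPrime := PrimeSpectrum.isPrime (R := CoordRing G) x
  have hheight : x.asIdeal.height ≤ 2 := by
    -- The stalk is the localization at the prime of `x`, so its dimension is the height of that
    -- prime.
    let k : Algebra (CoordRing G) ((TV G).presheaf.stalk x) :=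
      StructureSheaf.stalkAlgebra (CoordRing G) x
    have : IsLocalization.AtPrime ((TV G).presheaf.stalk x) x.asIdeal :=
      StructureSheaf.IsLocalization.to_stalk (CoordRing G) x
    rw [IsLocalization.AtPrime.ringKrullDim_eq_height x.asIdeal ((TV G).presheaf.stalk x)] at hx
    exact WithBot.coe_le_coe.mp hx
  obtain ⟨g, hg, _⟩ := exists_formallySmooth_localization hst hs ht hconn x.asIdeal hheight
  have : Algebra.FinitePresentation ℂ (CoordRing G) :=
    Algebra.FinitePresentation.of_finiteType.mp inferInstance
  have : LocallyOfFinitePresentation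
      (Spec.map (CommRingCat.ofHom (algebraMap ℂ (CoordRing G)))) :=
    inferInstanceAs (LocallyOfFinitePresentation (TV.structureMap G))
  exact mem_smoothLocus_of_localization x g hg

end Ring

theorem exists_endpoints {m n : ℕ} {G : SimpleGraph (Fin m ⊕ Fin n)}
    (hG : G ≤ completeBipartiteGraph (Fin m) (Fin n)) (e : G.edgeSet) :
    ∃ i j, e.1 = s(Sum.inl i, Sum.inr j) := by
  obtain ⟨e, he⟩ := e
  induction e using Sym2.ind with
  | _ u v =>
    have h := hG ((G.mem_edgeSet).mp he)
    rcases u with i | i <;> rcases v with j | j <;> simp at h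
    · exact ⟨i, j, rfl⟩
    · exact ⟨j, i, Sym2.eq_swap⟩

theorem isConnected_of_connected {V : Type} {G : SimpleGraph V} (hconn : G.Connected)
    {src tgt : G.edgeSet → V} (hst : ∀ e : G.edgeSet, e.1 = s(src e, tgt e)) :
    IsConnected src tgt := by
  intro X f hf u v
  obtain ⟨p⟩ := hconn.preconnected u v
  induction p with
  | nil => rfl
  | @cons u w v h p ih =>
    refine Eq.trans ?_ ih
    have he := hst ⟨s(u, w), h⟩
    have := hf ⟨s(u, w), h⟩
    rcases Sym2.eq_iff.mp he with ⟨h1, h2⟩ | ⟨h1, h2⟩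
    · exact (congrArg f h1).trans (this.trans (congrArg f h2).symm)
    · exact (congrArg f h1).trans (this.symm.trans (congrArg f h2).symm)

end BipartiteToric

end

theorem mainTheorem6 (m n : ℕ) (G : SimpleGraph (Fin m ⊕ Fin n))
    (hG : G ≤ completeBipartiteGraph (Fin m) (Fin n)) (hconn : G.Connected) :
    BipartiteToric.SmoothInCodim (BipartiteToric.TV.structureMap G) 2 ∧
      ∀ τ : PointedCone ℚ (BipartiteToric.NQ m n),
        τ.IsFaceOf (BipartiteToric.edgeCone G) → BipartiteToric.coneDim τ = 2 →
          BipartiteToric.GeneratedByPartOfBasis τ := by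
  choose a b hab using BipartiteToric.exists_endpoints hG
  have hc := BipartiteToric.isConnected_of_connected hconn hab
  have : Finite G.edgeSet := Subtype.finite
  -- The sign `ε` records the side of the bipartition.
  refine ⟨BipartiteToric.smoothInCodim_two hab (ε := Sum.elim (fun _ => 1) fun _ => -1)
    (fun _ => rfl) (fun _ => rfl) hc, fun τ hτ hdim =>
    BipartiteToric.generatedByPartOfBasis_of_isFaceOf (fun i j => ⟨fun h => ?_, ?_⟩) hc hτ hdim.le⟩
  · refine ⟨⟨s(Sum.inl i, Sum.inr j), h⟩, ?_⟩
    have := hab ⟨s(Sum.inl i, Sum.inr j), h⟩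
    simpa [eq_comm] using this
  · rintro ⟨e, rfl, rfl⟩
    rw [← SimpleGraph.mem_edgeSet, ← hab]
    exact e.2
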